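/- Let $\beta>1$ and let $t_\beta\in(0,1)$ be the unique positive solution of $t=\tanh(\beta t)$. For $n\ge 1$ let $\tilde\nu_{n,\beta}$ be the probability measure on $[0,1]$ with density proportional to $$p\mapsto \exp\Big(-\frac{n}{2\beta}\operatorname{Argtanh}(2p-1)^2-\Big(\frac n2+1\Big)\ln\big(1-(2p-1)^2\big)\Big).$$ Let $U_1,\dots,U_n$ be i.i.d. uniform on $[0,1]$ (a new family for each $n$ is allowed) and let $V_n\sim\tilde\nu_{n,\beta}$ be independent of $(U_1,\dots,U_n)$. Put $$X_k^{(\beta)}:=2\cdot\mathbf 1_{\{U_k<V_n\}}-1,\qquad M_n:=\sum_{k=1}^n X_k^{(\beta)},\qquad T_n:=2V_n-1 .$$ Let $(\hat Z(p))_{p\in[0,1]}$ be a standard Brownian bridge (continuous centred Gaussian process with $\mathbb E[\hat Z(p)\hat Z(q)]=p\wedge q-pq$), let $G^{\pm}:=2\hat Z\big(\tfrac{1\pm t_\beta}{2}\big)$, and let $B$ be uniform on $\{-1,1\}$ and independent of $(G^+,G^-)$. Then: 1. for every $n\ge1$, $(X_1^{(\beta)},\dots,X_n^{(\beta)})$ has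 the Curie--Weiss law at inverse temperature $\beta$, i.e. the law on $\{-1,1\}^n$ with probabilities proportional to $\exp\big(\frac{\beta}{2n}(x_1+\dots+x_n)^2\big)$, so $M_n$ is the Curie--Weiss magnetisation; 2. $\dfrac{M_n}{n}\to t_\beta B$ in law as $n\to\infty$; 3. the pair converges jointly in law as $n\to\infty$: $$\Big(\sqrt n\Big(\frac{M_n}{n}-T_n\Big),\,T_n\Big)\longrightarrow\Big(\frac{1+B}{2}G^++\frac{1-B}{2}G^-,\;t_\beta B\Big);$$ 4. $(G^+,G^-)$ is a centred Gaussian vector with $\mathbb E[G^+G^-]=(1-t_\beta)^2$. -/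

import Mathlib

/-!
Write `p = (1 + tanh y) / 2`. This change of variables turns the De Finetti density into `w ^ n`,
where `w y = exp (-y² / (2β)) cosh y`, and completing the square in `y` shows that the mixture over
`p` of `n` independent signs of mean `2p - 1` is the Curie–Weiss law (Hubbard–Stratonovich).

The logarithmic derivative of `w` is `tanh y - y / β`, and `tanh y / y` is decreasing on `(0, ∞)`,
so the even function `w` is maximal exactly at `y = ±β t`, where `tanh y = ±t`. By Laplace's method
`2 V n - 1` therefore converges in law to `t B`.

Given `V n = p`, the centred spins are independent with variance `1 - (2p - 1)²`, so when
`n r² → v` the conditional characteristic function at `r` of the centred magnetisation is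
`exp (-v (1 - (2p - 1)²) / 2) + o(1)` uniformly in `p`. Combining this with the concentration of
`p`, the joint characteristic function at `(r, b)` of the centred magnetisation and of `2 V n - 1`
converges to `exp (-v (1 - t²) / 2) cos (b t)`. Taking `r = a / n` and `b = a` gives the law of
large numbers, and `r = a / √n` the fluctuations, as `1 - t²` is the variance of both bridge values.
-/

open MeasureTheory ProbabilityTheory Filter Topology

noncomputable section

namespace CurieWeiss

/-- The symmetric Bernoulli law on `{-1, 1}`. -/
def signLaw : Measure ℝ :=
  (2⁻¹ : ENNReal) • Measure.dirac (1 : ℝ) + (2⁻¹ : ENNReal) • Measure.dirac (-1 : ℝ)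

/-- The Curie-Weiss law of `n` spins at inverse temperature `β` (no external field): the law of
`n` i.i.d. symmetric signs, biased by `exp (β / (2 n) * S_n ^ 2)` and normalised. -/
def curieWeissLaw (n : ℕ) (β : ℝ) : Measure (Fin n → ℝ) :=
  (Measure.pi fun _ : Fin n => signLaw).tilted fun x => β / (2 * n) * (∑ k, x k) ^ 2

/-- The density of the De Finetti measure on `[0, 1]`, before normalisation. -/
def deFinettiWeight (n : ℕ) (β p : ℝ) : ℝ :=
  Real.exp (-(n / (2 * β)) * Real.artanh (2 * p - 1) ^ 2
    - ((n : ℝ) / 2 + 1) * Real.log (1 - (2 * p - 1) ^ 2))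

/-- The De Finetti measure of the Curie-Weiss model with `n ≥ 1` spins. -/
def deFinettiMeasure (n : ℕ) (β : ℝ) : Measure ℝ :=
  (volume.restrict (Set.Icc (0 : ℝ) 1)).withDensity fun p =>
    ENNReal.ofReal (deFinettiWeight n β p / ∫ q in Set.Icc (0 : ℝ) 1, deFinettiWeight n β q)

/-- The spin `2 * 1_{u < p} - 1`: for `u` uniform on `[0, 1]`, a sign that is `1` with
probability `p`. -/
def spin (u p : ℝ) : ℝ := 2 * (if u < p then 1 else 0) - 1

/-- The unnormalised magnetisation built from the uniform variables `u` and the parameter `p`. -/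
def magnetisation {n : ℕ} (u : Fin n → ℝ) (p : ℝ) : ℝ := ∑ k, spin (u k) p

/-- `Z` restricted to the time interval `[0, 1]` is a standard Brownian bridge from `0` to `0`:
a centred Gaussian process with covariance `min p q - p * q` and almost surely continuous paths. -/
structure IsBrownianBridge {Ω : Type*} [MeasurableSpace Ω] (Z : ℝ → Ω → ℝ) (P : Measure Ω) :
    Prop where
  isGaussianProcess : IsGaussianProcess (fun p : Set.Icc (0 : ℝ) 1 => Z p) P
  centred : ∀ p ∈ Set.Icc (0 : ℝ) 1, ∫ ω, Z p ω ∂P = 0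
  covariance : ∀ p ∈ Set.Icc (0 : ℝ) 1, ∀ q ∈ Set.Icc (0 : ℝ) 1,
    ∫ ω, Z p ω * Z q ω ∂P = min p q - p * q
  continuousOn : ∀ᵐ ω ∂P, ContinuousOn (fun p => Z p ω) (Set.Icc 0 1)

end CurieWeiss

end

namespace CurieWeiss

section Laplace

variable {α E : Type*} [MeasurableSpace α] {μ : Measure α} {c : α → ℝ} {M : ℝ}

lemma integrable_pow_smul_of_bounded [NormedAddCommGroup E] [NormedSpace ℝ E] {g : α → E}
    (hc₀ : ∀ x, 0 ≤ c x) (hcM : ∀ x, c x ≤ M) (hc : Integrable c μ)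
    (hcg : Integrable (fun x => c x • g x) μ) {n : ℕ} (hn : n ≠ 0) :
    Integrable (fun x => c x ^ n • g x) μ := by
  obtain ⟨k, rfl⟩ := Nat.exists_eq_succ_of_ne_zero hn
  simp only [pow_succ, mul_smul]
  refine hcg.bdd_smul (M ^ k) (hc.aestronglyMeasurable.pow k) (ae_of_all _ fun x => ?_)
  rw [norm_pow, Real.norm_of_nonneg (hc₀ x)]
  exact pow_le_pow_left₀ (hc₀ x) (hcM x) k

lemma integrable_pow_of_bounded (hc₀ : ∀ x, 0 ≤ c x) (hcM : ∀ x, c x ≤ M) (hc : Integrable c μ)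
    {n : ℕ} (hn : n ≠ 0) : Integrable (fun x => c x ^ n) μ := by
  simpa only [smul_eq_mul, mul_one] using
    integrable_pow_smul_of_bounded (g := fun _ => (1 : ℝ)) hc₀ hcM hc (by simpa using hc) hn

lemma pow_mul_measureReal_le_integral_pow (hc₀ : ∀ x, 0 ≤ c x) {r : ℝ} (hr : 0 < r) {n : ℕ}
    (hc : Integrable (fun x => c x ^ n) μ) :
    r ^ n * μ.real {x | r ≤ c x} ≤ ∫ x, c x ^ n ∂μ := by
  have hrn : 0 < r ^ n := by positivity
  calc r ^ n * μ.real {x | r ≤ c x}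
      ≤ r ^ n * μ.real {x | r ^ n ≤ c x ^ n} := by
        refine mul_le_mul_of_nonneg_left (measureReal_mono (fun x hx => ?_)
          (hc.measure_ge_lt_top hrn).ne) hrn.le
        exact pow_le_pow_left₀ hr.le hx n
    _ ≤ ∫ x, c x ^ n ∂μ :=
        mul_meas_ge_le_integral_of_nonneg (ae_of_all _ fun x => pow_nonneg (hc₀ x) n) hc _

lemma measureReal_le_pos {r : ℝ} (hr : 0 < r) (hc : Integrable c μ) (hμ : 0 < μ {x | r < c x}) :
    0 < μ.real {x | r ≤ c x} :=
  ENNReal.toReal_pos (hμ.trans_le (measure_mono fun x (hx : r < c x) => hx.le)).ne'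
    (hc.measure_ge_lt_top hr).ne

lemma integral_pow_succ_mul_le {h : α → ℝ} {ε r : ℝ} (hc₀ : ∀ x, 0 ≤ c x)
    (hcM : ∀ x, c x ≤ M) (hc : Integrable c μ) (hh : ∀ x, 0 ≤ h x)
    (hch : Integrable (fun x => c x * h x) μ) (hr : 0 ≤ r) (hgap : ∀ x, ε ≤ h x → c x ≤ r)
    (hε : 0 ≤ ε) (n : ℕ) :
    ∫ x, c x ^ (n + 1) * h x ∂μ ≤ ε * ∫ x, c x ^ (n + 1) ∂μ + r ^ n * ∫ x, c x * h x ∂μ := by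
  have hcn := integrable_pow_of_bounded hc₀ hcM hc n.succ_ne_zero
  rw [← integral_const_mul, ← integral_const_mul,
    ← integral_add (hcn.const_mul ε) (hch.const_mul (r ^ n))]
  refine integral_mono (integrable_pow_smul_of_bounded hc₀ hcM hc hch n.succ_ne_zero)
    ((hcn.const_mul ε).add (hch.const_mul (r ^ n))) fun x => ?_
  have hc₀x := hc₀ x
  have hhx := hh x
  rcases le_total ε (h x) with hx | hx
  · calc c x ^ (n + 1) * h x = c x ^ n * (c x * h x) := by ring
      _ ≤ r ^ n * (c x * h x) := by gcongr; exact hgap x hx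
      _ ≤ ε * c x ^ (n + 1) + r ^ n * (c x * h x) := le_add_of_nonneg_left (by positivity)
  · calc c x ^ (n + 1) * h x ≤ c x ^ (n + 1) * ε := by gcongr
      _ ≤ ε * c x ^ (n + 1) + r ^ n * (c x * h x) := by
        rw [mul_comm]; exact le_add_of_nonneg_right (by positivity)

lemma tendsto_integral_pow_mul_div_of_gap {h : α → ℝ} (hc₀ : ∀ x, 0 ≤ c x)
    (hcM : ∀ x, c x ≤ M) (hM : 0 < M) (hc : Integrable c μ) (hμ : ∀ r < M, 0 < μ {x | r < c x})
    (hh : ∀ x, 0 ≤ h x) (hch : Integrable (fun x => c x * h x) μ)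
    (hgap : ∀ ε > 0, ∃ r < M, ∀ x, ε ≤ h x → c x ≤ r) :
    Tendsto (fun n : ℕ => (∫ x, c x ^ n * h x ∂μ) / ∫ x, c x ^ n ∂μ) atTop (𝓝 0) := by
  rw [← tendsto_add_atTop_iff_nat 1]
  refine tendsto_order.2 ⟨fun a ha => Eventually.of_forall fun n => ha.trans_le <| div_nonneg
    (integral_nonneg fun x => mul_nonneg (pow_nonneg (hc₀ x) _) (hh x))
    (integral_nonneg fun x => pow_nonneg (hc₀ x) _), fun ε hε => ?_⟩
  obtain ⟨r₀, hr₀M, hr₀⟩ := hgap (ε / 2) (half_pos hε)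
  set r := max r₀ 0
  obtain ⟨s, hrs, hsM⟩ := exists_between (max_lt hr₀M hM : r < M)
  have hr : 0 ≤ r := le_max_right _ _
  have hs : 0 < s := hr.trans_lt hrs
  have hpos := measureReal_le_pos hs hc (hμ s hsM)
  set C := (∫ x, c x * h x ∂μ) / (s * μ.real {x | s ≤ c x})
  have hC : 0 ≤ C :=
    div_nonneg (integral_nonneg fun x => mul_nonneg (hc₀ x) (hh x)) (by positivity)
  have hlim : Tendsto (fun n : ℕ => ε / 2 + C * (r / s) ^ n) atTop (𝓝 (ε / 2)) := by
    simpa using ((tendsto_pow_atTop_nhds_zero_of_lt_one (by positivity)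
      ((div_lt_one hs).2 hrs)).const_mul C).const_add (ε / 2)
  filter_upwards [hlim.eventually_lt_const (half_lt_self hε)] with n hn
  refine lt_of_le_of_lt ?_ hn
  have hden := pow_mul_measureReal_le_integral_pow hc₀ hs
    (integrable_pow_of_bounded hc₀ hcM hc n.succ_ne_zero)
  rw [div_le_iff₀ (lt_of_lt_of_le (by positivity) hden), add_mul]
  calc ∫ x, c x ^ (n + 1) * h x ∂μ
      ≤ ε / 2 * ∫ x, c x ^ (n + 1) ∂μ + r ^ n * ∫ x, c x * h x ∂μ :=
        integral_pow_succ_mul_le hc₀ hcM hc hh hch hr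
          (fun x hx => (hr₀ x hx).trans (le_max_left _ _)) (half_pos hε).le n
    _ = ε / 2 * ∫ x, c x ^ (n + 1) ∂μ
          + C * (r / s) ^ n * (s ^ (n + 1) * μ.real {x | s ≤ c x}) := by
        simp only [C, div_pow, pow_succ]
        field_simp
    _ ≤ _ := by gcongr

theorem tendsto_inv_integral_pow_smul_of_gap [NormedAddCommGroup E] [NormedSpace ℝ E]
    [CompleteSpace E] {g : α → E} {L : E} (hc₀ : ∀ x, 0 ≤ c x) (hcM : ∀ x, c x ≤ M) (hM : 0 < M)
    (hc : Integrable c μ) (hμ : ∀ r < M, 0 < μ {x | r < c x})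
    (hcg : Integrable (fun x => c x • g x) μ)
    (hgap : ∀ ε > 0, ∃ r < M, ∀ x, ε ≤ ‖g x - L‖ → c x ≤ r) :
    Tendsto (fun n : ℕ => (∫ x, c x ^ n ∂μ)⁻¹ • ∫ x, c x ^ n • g x ∂μ) atTop (𝓝 L) := by
  have hcL : Integrable (fun x => c x • (g x - L)) μ := by
    simp only [smul_sub]
    exact hcg.sub (hc.smul_const L)
  have hch : Integrable (fun x => c x * ‖g x - L‖) μ :=
    hcL.norm.congr (ae_of_all _ fun x => by simp only [norm_smul, Real.norm_of_nonneg (hc₀ x)])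
  refine tendsto_iff_norm_sub_tendsto_zero.2 <| squeeze_zero' (Eventually.of_forall fun n =>
    norm_nonneg _) ?_ (tendsto_integral_pow_mul_div_of_gap hc₀ hcM hM hc hμ
      (fun x => norm_nonneg _) hch hgap)
  filter_upwards [eventually_ne_atTop 0] with n hn
  have hcn := integrable_pow_of_bounded hc₀ hcM hc hn
  have hpos : 0 < ∫ x, c x ^ n ∂μ := by
    have := measureReal_le_pos (half_pos hM) hc (hμ (M / 2) (half_lt_self hM))
    exact lt_of_lt_of_le (by positivity)
      (pow_mul_measureReal_le_integral_pow hc₀ (half_pos hM) hcn)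
  calc ‖(∫ x, c x ^ n ∂μ)⁻¹ • ∫ x, c x ^ n • g x ∂μ - L‖
      = ‖(∫ x, c x ^ n ∂μ)⁻¹ • ∫ x, c x ^ n • (g x - L) ∂μ‖ := by
        simp only [smul_sub]
        rw [integral_sub (integrable_pow_smul_of_bounded hc₀ hcM hc hcg hn) (hcn.smul_const L),
          integral_smul_const, smul_sub, inv_smul_smul₀ hpos.ne']
    _ ≤ (∫ x, c x ^ n ∂μ)⁻¹ * ∫ x, ‖c x ^ n • (g x - L)‖ ∂μ := by
        rw [norm_smul, norm_inv, Real.norm_of_nonneg hpos.le]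
        gcongr
        exact norm_integral_le_integral_norm _
    _ = (∫ x, c x ^ n * ‖g x - L‖ ∂μ) / ∫ x, c x ^ n ∂μ := by
        simp only [norm_smul, norm_pow, Real.norm_of_nonneg (hc₀ _), inv_mul_eq_div]

end Laplace

section Tanh

lemma one_sub_tanh_sq (y : ℝ) : 1 - Real.tanh y ^ 2 = (Real.cosh y ^ 2)⁻¹ := by
  have hcosh := (Real.cosh_pos y).ne'
  rw [Real.tanh_eq_sinh_div_cosh]
  field_simp
  exact Real.cosh_sq_sub_sinh_sq y

lemma hasDerivAt_tanh (y : ℝ) : HasDerivAt Real.tanh (Real.cosh y ^ 2)⁻¹ y := by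
  have h := (Real.hasDerivAt_sinh y).div (Real.hasDerivAt_cosh y) (Real.cosh_pos y).ne'
  rw [← show Real.tanh = Real.sinh / Real.cosh from funext Real.tanh_eq_sinh_div_cosh] at h
  exact h.congr_deriv (by rw [← sq, ← sq, Real.cosh_sq_sub_sinh_sq, one_div])

lemma continuous_tanh : Continuous Real.tanh :=
  continuous_iff_continuousAt.2 fun y => (hasDerivAt_tanh y).continuousAt

lemma strictConcaveOn_tanh : StrictConcaveOn ℝ (Set.Ici 0) Real.tanh := by
  refine StrictAntiOn.strictConcaveOn_of_deriv (convex_Ici 0) continuous_tanh.continuousOn ?_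
  rw [interior_Ici]
  intro x hx y hy hxy
  simp only [(hasDerivAt_tanh _).deriv]
  have hcosh : Real.cosh x < Real.cosh y :=
    Real.cosh_lt_cosh.2 (by rwa [abs_of_pos hx, abs_of_pos hy])
  have := Real.cosh_pos x
  gcongr

lemma strictAntiOn_tanh_div_self : StrictAntiOn (fun y => Real.tanh y / y) (Set.Ioi 0) := by
  intro x (hx : 0 < x) y (hy : 0 < y) hxy
  simpa using strictConcaveOn_tanh.secant_strict_mono (a := 0) Set.self_mem_Ici hx.le hy.le hx.ne'
    hy.ne' hxy

lemma image_half_one_add_tanh :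
    (fun y => (1 + Real.tanh y) / 2) '' Set.univ = Set.Ioo (0 : ℝ) 1 := by
  ext p
  constructor
  · rintro ⟨y, -, rfl⟩
    constructor <;> linarith [Real.neg_one_lt_tanh y, Real.tanh_lt_one y]
  · rintro ⟨hp0, hp1⟩
    refine ⟨Real.artanh (2 * p - 1), trivial, ?_⟩
    simp only [Real.tanh_artanh (x := 2 * p - 1) ⟨by linarith, by linarith⟩]
    ring

end Tanh

section HubbardStratonovich

/-- The Hubbard–Stratonovich weight `exp (-y² / (2β)) cosh y`. Through `p = (1 + tanh y) / 2` its
`n`-th power becomes the density of the De Finetti measure of `n` spins. -/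
noncomputable def hsWeight (β y : ℝ) : ℝ := Real.exp (-y ^ 2 / (2 * β)) * Real.cosh y

variable {β t : ℝ}

lemma hsWeight_pos (β y : ℝ) : 0 < hsWeight β y := by
  unfold hsWeight
  positivity

lemma continuous_hsWeight (β : ℝ) : Continuous (hsWeight β) := by
  unfold hsWeight
  fun_prop

lemma hsWeight_neg (β y : ℝ) : hsWeight β (-y) = hsWeight β y := by
  simp only [hsWeight, neg_sq, Real.cosh_neg]

lemma hsWeight_abs (β y : ℝ) : hsWeight β |y| = hsWeight β y := by
  simp only [hsWeight, sq_abs, Real.cosh_abs]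

lemma hsWeight_eq_gaussian_mixture (hβ : 0 < β) (y : ℝ) :
    hsWeight β y = Real.exp (β / 2) / 2 *
      (Real.exp (-(1 / (2 * β)) * (y - β) ^ 2) + Real.exp (-(1 / (2 * β)) * (y + β) ^ 2)) := by
  rw [hsWeight, Real.cosh_eq, mul_add, div_mul_eq_mul_div, div_mul_eq_mul_div, ← Real.exp_add,
    ← Real.exp_add, mul_div_assoc', mul_add, ← Real.exp_add, ← Real.exp_add, ← add_div]
  congr 3 <;> · field_simp; ring

lemma integrable_hsWeight (hβ : 0 < β) : Integrable (hsWeight β) := by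
  have h := integrable_exp_neg_mul_sq (b := 1 / (2 * β)) (by positivity)
  exact (((h.comp_sub_right β).add (h.comp_add_right β)).const_mul _).congr
    (ae_of_all _ fun y => (hsWeight_eq_gaussian_mixture hβ y).symm)

lemma hsWeight_le_exp (hβ : 0 < β) (y : ℝ) : hsWeight β y ≤ Real.exp (β / 2) := by
  have hexp : ∀ u : ℝ, Real.exp (-(1 / (2 * β)) * u ^ 2) ≤ 1 := fun u =>
    Real.exp_le_one_iff.2 (by rw [neg_mul]; exact neg_nonpos.2 (by positivity))
  rw [hsWeight_eq_gaussian_mixture hβ]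
  nlinarith [Real.exp_pos (β / 2), hexp (y - β), hexp (y + β)]

lemma integrable_hsWeight_pow (hβ : 0 < β) {n : ℕ} (hn : n ≠ 0) :
    Integrable (fun y => hsWeight β y ^ n) :=
  integrable_pow_of_bounded (fun y => (hsWeight_pos β y).le) (hsWeight_le_exp hβ)
    (integrable_hsWeight hβ) hn

lemma integral_hsWeight_pow_pos (hβ : 0 < β) {n : ℕ} (hn : n ≠ 0) :
    0 < ∫ y, hsWeight β y ^ n :=
  integral_pos_of_integrable_nonneg_nonzero (x := 0) ((continuous_hsWeight β).pow n)
    (integrable_hsWeight_pow hβ hn) (fun y => (pow_pos (hsWeight_pos β y) n).le)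
    (pow_pos (hsWeight_pos β 0) n).ne'

lemma hasDerivAt_hsWeight (β y : ℝ) :
    HasDerivAt (hsWeight β) (hsWeight β y * (Real.tanh y - y / β)) y := by
  have hexp : HasDerivAt (fun y : ℝ => -y ^ 2 / (2 * β)) (-(2 * y) / (2 * β)) y := by
    simpa using (hasDerivAt_pow 2 y).neg.div_const (2 * β)
  refine (hexp.exp.mul (Real.hasDerivAt_cosh y)).congr_deriv ?_
  have := (Real.cosh_pos y).ne'
  rw [hsWeight, Real.tanh_eq_sinh_div_cosh, neg_div (2 * β) (2 * y),
    mul_div_mul_left _ _ two_ne_zero]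
  field_simp
  ring

lemma strictMonoOn_hsWeight (ht_pos : 0 < t) (ht : t = Real.tanh (β * t)) :
    StrictMonoOn (hsWeight β) (Set.Icc 0 (β * t)) := by
  refine strictMonoOn_of_deriv_pos (convex_Icc _ _) (continuous_hsWeight β).continuousOn ?_
  rw [interior_Icc]
  rintro y ⟨hy, hyt⟩
  have h : Real.tanh (β * t) / (β * t) < Real.tanh y / y :=
    strictAntiOn_tanh_div_self hy (hy.trans hyt) hyt
  rw [← ht, div_mul_cancel_right₀ ht_pos.ne', lt_div_iff₀ hy, inv_mul_eq_div] at h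
  rw [(hasDerivAt_hsWeight β y).deriv]
  exact mul_pos (hsWeight_pos β y) (sub_pos.2 h)

lemma strictAntiOn_hsWeight (hβ : 0 < β) (ht_pos : 0 < t) (ht : t = Real.tanh (β * t)) :
    StrictAntiOn (hsWeight β) (Set.Ici (β * t)) := by
  refine strictAntiOn_of_deriv_neg (convex_Ici _) (continuous_hsWeight β).continuousOn ?_
  rw [interior_Ici]
  intro y hty
  have hb : 0 < β * t := by positivity
  have hy : 0 < y := hb.trans hty
  have h : Real.tanh y / y < Real.tanh (β * t) / (β * t) := strictAntiOn_tanh_div_self hb hy hty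
  rw [← ht, div_mul_cancel_right₀ ht_pos.ne', div_lt_iff₀ hy, inv_mul_eq_div] at h
  rw [(hasDerivAt_hsWeight β y).deriv]
  exact mul_neg_of_pos_of_neg (hsWeight_pos β y) (sub_neg.2 h)

lemma hsWeight_le (hβ : 0 < β) (ht_pos : 0 < t) (ht : t = Real.tanh (β * t)) (y : ℝ) :
    hsWeight β y ≤ hsWeight β (β * t) := by
  rw [← hsWeight_abs β y]
  have hb : 0 < β * t := by positivity
  rcases le_total |y| (β * t) with hy | hy
  · exact (strictMonoOn_hsWeight ht_pos ht).monotoneOn ⟨abs_nonneg y, hy⟩ ⟨hb.le, le_rfl⟩ hy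
  · exact (strictAntiOn_hsWeight hβ ht_pos ht).antitoneOn Set.self_mem_Ici hy hy

lemma exists_lt_forall_le_of_strictMonoOn_of_strictAntiOn {f : ℝ → ℝ} {a b δ : ℝ} (hab : a < b)
    (hδ : 0 < δ) (hmono : StrictMonoOn f (Set.Icc a b)) (hanti : StrictAntiOn f (Set.Ici b)) :
    ∃ r < f b, ∀ y, a ≤ y → δ ≤ |y - b| → f y ≤ r := by
  obtain ⟨ε, hε, hεlt⟩ := exists_between (lt_min hδ (sub_pos.2 hab))
  obtain ⟨hεδ, hεb⟩ := lt_min_iff.1 hεlt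
  have hl : b - ε ∈ Set.Icc a b := ⟨by linarith, by linarith⟩
  have hr : b + ε ∈ Set.Ici b := by simpa using hε.le
  refine ⟨max (f (b - ε)) (f (b + ε)), max_lt (hmono hl ⟨hab.le, le_rfl⟩ (by linarith))
    (hanti Set.self_mem_Ici hr (by linarith)), fun y hy hd => ?_⟩
  rcases le_abs.1 (hεδ.le.trans hd) with h | h
  · exact le_max_of_le_right <|
      hanti.antitoneOn hr (Set.mem_Ici.2 (by linarith)) (by linarith)
  · exact le_max_of_le_left <| hmono.monotoneOn ⟨hy, by linarith⟩ hl (by linarith)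

lemma hsWeight_gap (hβ : 0 < β) (ht_pos : 0 < t) (ht : t = Real.tanh (β * t)) {δ : ℝ}
    (hδ : 0 < δ) :
    ∃ r < hsWeight β (β * t), ∀ y, δ ≤ |(|y| - β * t)| → hsWeight β y ≤ r := by
  obtain ⟨r, hr, hle⟩ := exists_lt_forall_le_of_strictMonoOn_of_strictAntiOn
    (by positivity : 0 < β * t) hδ (strictMonoOn_hsWeight ht_pos ht)
    (strictAntiOn_hsWeight hβ ht_pos ht)
  exact ⟨r, hr, fun y hy => hsWeight_abs β y ▸ hle |y| (abs_nonneg y) hy⟩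

end HubbardStratonovich

section Concentration

variable {E : Type*} [NormedAddCommGroup E] [NormedSpace ℝ E] {β t : ℝ}

lemma tendsto_integral_hsWeight_pow_smul_of_even [CompleteSpace E] (hβ : 0 < β) (ht_pos : 0 < t)
    (ht : t = Real.tanh (β * t)) {g : ℝ → E} (hg : Continuous g) (hg_even : ∀ y, g (-y) = g y)
    {C : ℝ} (hC : ∀ y, ‖g y‖ ≤ C) :
    Tendsto (fun n : ℕ => (∫ y, hsWeight β y ^ n)⁻¹ • ∫ y, hsWeight β y ^ n • g y) atTop
      (𝓝 (g (β * t))) := by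
  have hcont := continuous_hsWeight β
  refine tendsto_inv_integral_pow_smul_of_gap (fun y => (hsWeight_pos β y).le)
    (hsWeight_le hβ ht_pos ht) (hsWeight_pos β _) (integrable_hsWeight hβ) (fun r hr => ?_)
    ((integrable_hsWeight hβ).smul_bdd C hg.aestronglyMeasurable (ae_of_all _ hC)) fun ε hε => ?_
  · exact (isOpen_lt continuous_const hcont).measure_pos volume ⟨β * t, hr⟩
  · obtain ⟨δ, hδ, hnear⟩ := Metric.continuousAt_iff.1 hg.continuousAt ε hε
    obtain ⟨r, hr, hgap⟩ := hsWeight_gap hβ ht_pos ht hδ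
    have hg_abs : ∀ y, g |y| = g y := fun y => by
      rcases abs_choice y with h | h <;> rw [h]
      exact hg_even y
    refine ⟨r, hr, fun y hy => hgap y (not_lt.1 fun hlt => hy.not_gt ?_)⟩
    rw [← hg_abs, ← dist_eq_norm]
    exact hnear hlt

lemma integral_smul_eq_integral_smul_symmetrization {w : ℝ → ℝ} (hw : ∀ y, w (-y) = w y)
    {f : ℝ → E} (hwf : Integrable (fun y => w y • f y)) :
    ∫ y, w y • f y = ∫ y, w y • ((1 / 2 : ℝ) • (f y + f (-y))) := by
  have hneg : Integrable (fun y => w y • f (-y)) := by simpa only [hw] using hwf.comp_neg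
  have heq : ∫ y, w y • f (-y) = ∫ y, w y • f y := by
    simpa only [hw] using integral_neg_eq_self (fun y => w y • f y) volume
  simp only [smul_comm (w _) (1 / 2 : ℝ), smul_add (w _)]
  rw [integral_smul, integral_add hwf hneg, heq, ← two_smul ℝ, smul_smul, one_div,
    inv_mul_cancel₀ two_ne_zero, one_smul]

lemma deFinettiWeight_tanh (n : ℕ) (β y : ℝ) :
    deFinettiWeight n β ((1 + Real.tanh y) / 2) = hsWeight β y ^ n * Real.cosh y ^ 2 := by
  have hcosh := Real.cosh_pos y
  have harg : 2 * ((1 + Real.tanh y) / 2) - 1 = Real.tanh y := by ring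
  rw [deFinettiWeight, harg, Real.artanh_tanh, one_sub_tanh_sq, Real.log_inv, Real.log_pow,
    hsWeight, mul_pow, ← Real.exp_nat_mul, mul_assoc, ← pow_add,
    ← Real.exp_log (pow_pos hcosh (n + 2)), Real.log_pow, ← Real.exp_add]
  congr 1
  push_cast
  ring

lemma measurable_deFinettiWeight (n : ℕ) (β : ℝ) : Measurable (deFinettiWeight n β) := by
  unfold deFinettiWeight Real.artanh
  fun_prop

lemma setIntegral_deFinettiWeight_smul (n : ℕ) (β : ℝ) (F : ℝ → E) :
    ∫ p in Set.Icc (0 : ℝ) 1, deFinettiWeight n β p • F p =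
      (1 / 2 : ℝ) • ∫ y, hsWeight β y ^ n • F ((1 + Real.tanh y) / 2) := by
  have hinj : Set.InjOn (fun y => (1 + Real.tanh y) / 2) Set.univ := fun x _ y _ h =>
    Real.tanh_injective (by simpa using h)
  rw [integral_Icc_eq_integral_Ioo, ← image_half_one_add_tanh,
    integral_image_eq_integral_abs_deriv_smul MeasurableSet.univ
      (fun y _ => (((hasDerivAt_tanh y).const_add 1).div_const 2).hasDerivWithinAt) hinj,
    ← integral_smul, Measure.restrict_univ]
  refine integral_congr_ae (ae_of_all _ fun y => ?_)
  simp only [deFinettiWeight_tanh, smul_smul]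
  congr 1
  rw [abs_of_pos (by positivity)]
  field_simp

theorem integral_deFinettiMeasure (n : ℕ) (β : ℝ) (F : ℝ → E) :
    ∫ p, F p ∂deFinettiMeasure n β =
      (∫ y, hsWeight β y ^ n)⁻¹ • ∫ y, hsWeight β y ^ n • F ((1 + Real.tanh y) / 2) := by
  have hmeas := measurable_deFinettiWeight n β
  have hnonneg : ∀ p, 0 ≤ deFinettiWeight n β p := fun p => (Real.exp_pos _).le
  have hnorm : ∫ q in Set.Icc (0 : ℝ) 1, deFinettiWeight n β q = 1 / 2 * ∫ y, hsWeight β y ^ n := by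
    simpa using setIntegral_deFinettiWeight_smul n β fun _ => (1 : ℝ)
  rw [deFinettiMeasure, integral_withDensity_eq_integral_toReal_smul (by fun_prop) (by simp)]
  simp only [ENNReal.toReal_ofReal (div_nonneg (hnonneg _) (integral_nonneg hnonneg))]
  simp only [div_eq_inv_mul (deFinettiWeight n β _), mul_smul]
  rw [integral_smul, setIntegral_deFinettiWeight_smul, hnorm, smul_smul, mul_inv, one_div, inv_inv,
    mul_right_comm, mul_inv_cancel₀ two_ne_zero, one_mul]

lemma ae_mem_Icc_deFinettiMeasure (n : ℕ) (β : ℝ) :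
    ∀ᵐ p ∂deFinettiMeasure n β, p ∈ Set.Icc (0 : ℝ) 1 :=
  (withDensity_absolutelyContinuous _ _).ae_le (ae_restrict_mem measurableSet_Icc)

lemma isProbabilityMeasure_deFinettiMeasure (hβ : 0 < β) {n : ℕ} (hn : n ≠ 0) :
    IsProbabilityMeasure (deFinettiMeasure n β) := by
  have h := integral_deFinettiMeasure n β fun _ => (1 : ℝ)
  simp only [integral_const, smul_eq_mul, mul_one,
    inv_mul_cancel₀ (integral_hsWeight_pow_pos hβ hn).ne'] at h
  exact ⟨(ENNReal.toReal_eq_one_iff _).1 h⟩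

theorem tendsto_integral_deFinettiMeasure [CompleteSpace E] (hβ : 0 < β) (ht_pos : 0 < t)
    (ht : t = Real.tanh (β * t)) {f : ℝ → E} (hf : Continuous f) {C : ℝ} (hC : ∀ x, ‖f x‖ ≤ C) :
    Tendsto (fun n : ℕ => ∫ p, f (2 * p - 1) ∂deFinettiMeasure n β) atTop
      (𝓝 ((1 / 2 : ℝ) • (f t + f (-t)))) := by
  have htanh := continuous_tanh
  set g : ℝ → E := fun y => (1 / 2 : ℝ) • (f (Real.tanh y) + f (Real.tanh (-y)))
  have hlim := tendsto_integral_hsWeight_pow_smul_of_even hβ ht_pos ht (g := g) (by fun_prop)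
    (fun y => by simp only [g, neg_neg, add_comm]) (C := C) fun y => by
      rw [norm_smul, Real.norm_of_nonneg (by norm_num)]
      linarith [norm_add_le_of_le (hC (Real.tanh y)) (hC (Real.tanh (-y)))]
  simp only [g, Real.tanh_neg, ← ht] at hlim
  refine hlim.congr' ?_
  filter_upwards [eventually_ne_atTop 0] with n hn
  have hint := (integrable_hsWeight_pow hβ hn).smul_bdd (f := fun y => f (Real.tanh y)) C
    (hf.comp htanh).aestronglyMeasurable (ae_of_all _ fun y => hC _)
  have hsymm := integral_smul_eq_integral_smul_symmetrization
    (fun y => by rw [hsWeight_neg]) hint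
  have harg : ∀ y, 2 * ((1 + Real.tanh y) / 2) - 1 = Real.tanh y := fun y => by ring
  simp only [integral_deFinettiMeasure, harg, hsymm, Real.tanh_neg]

end Concentration

section Sign

lemma integral_signLaw {E : Type*} [NormedAddCommGroup E] [NormedSpace ℝ E] [CompleteSpace E]
    (f : ℝ → E) : ∫ x, f x ∂signLaw = (1 / 2 : ℝ) • (f 1 + f (-1)) := by
  have hint : ∀ a : ℝ, Integrable f ((2⁻¹ : ENNReal) • Measure.dirac a) := fun a =>
    (integrable_dirac (by simp)).smul_measure (by simp)
  rw [signLaw, integral_add_measure (hint 1) (hint (-1)), integral_smul_measure,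
    integral_smul_measure, integral_dirac, integral_dirac, smul_add]
  simp

lemma ae_signLaw : ∀ᵐ x ∂signLaw, x = 1 ∨ x = -1 := by
  simp only [signLaw, ae_add_measure_iff]
  constructor <;> exact Measure.ae_smul_measure (by simp [ae_dirac_eq]) _

instance : IsProbabilityMeasure signLaw where
  measure_univ := by simp [signLaw, ENNReal.inv_two_add_inv_two]

lemma ae_pi_signLaw {ι : Type*} [Fintype ι] :
    ∀ᵐ x ∂Measure.pi fun _ : ι => signLaw, ∀ k, x k = 1 ∨ x k = -1 :=
  ae_all_iff.2 fun k =>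
    (measurePreserving_eval (fun _ : ι => signLaw) k).quasiMeasurePreserving.ae ae_signLaw

lemma measurable_spin : Measurable fun q : ℝ × ℝ => spin q.1 q.2 :=
  ((Measurable.ite (measurableSet_lt measurable_fst measurable_snd) measurable_const
    measurable_const).const_mul 2).sub_const 1

lemma spin_eq_one_or (u p : ℝ) : spin u p = 1 ∨ spin u p = -1 := by
  unfold spin
  split_ifs <;> norm_num

instance : IsProbabilityMeasure (volume.restrict (Set.Icc (0 : ℝ) 1)) := ⟨by simp⟩

lemma integral_comp_spin {E : Type*} [NormedAddCommGroup E] [NormedSpace ℝ E] [CompleteSpace E]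
    (f : ℝ → E) {p : ℝ} (hp : p ∈ Set.Icc (0 : ℝ) 1) :
    ∫ u in Set.Icc (0 : ℝ) 1, f (spin u p) = p • f 1 + (1 - p) • f (-1) := by
  have hspin : ∀ u, f (spin u p) = f (-1) + (Set.Iio p).indicator (fun _ => f 1 - f (-1)) u := by
    intro u
    by_cases hu : u < p
    · rw [Set.indicator_of_mem (Set.mem_Iio.2 hu), spin, if_pos hu, add_sub_cancel]
      norm_num
    · rw [Set.indicator_of_notMem (by simpa using hu), spin, if_neg hu, add_zero]
      norm_num
  have hvol : (volume.restrict (Set.Icc (0 : ℝ) 1)).real (Set.Iio p) = p := by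
    have hset : Set.Iio p ∩ Set.Icc 0 1 = Set.Ico 0 p := by
      ext u
      simp only [Set.mem_inter_iff, Set.mem_Iio, Set.mem_Icc, Set.mem_Ico]
      exact ⟨fun h => ⟨h.2.1, h.1⟩, fun h => ⟨h.2, h.1, h.2.le.trans hp.2⟩⟩
    rw [measureReal_restrict_apply measurableSet_Iio, hset, Real.volume_real_Ico_of_le hp.1,
      sub_zero]
  simp only [hspin]
  rw [integral_add (integrable_const _) ((integrable_const _).indicator measurableSet_Iio),
    integral_indicator_const _ measurableSet_Iio, hvol, integral_const, probReal_univ, one_smul]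
  module

lemma integral_comp_spin_eq_integral_signLaw {E : Type*} [NormedAddCommGroup E] [NormedSpace ℝ E]
    [CompleteSpace E] (f : ℝ → E) {p : ℝ} (hp : p ∈ Set.Icc (0 : ℝ) 1) :
    ∫ u in Set.Icc (0 : ℝ) 1, f (spin u p) = ∫ x, (1 + (2 * p - 1) * x) • f x ∂signLaw := by
  rw [integral_comp_spin f hp, integral_signLaw]
  module

end Sign

section Coupling

lemma integral_mul_prod_of_indepFun {Ω 𝓧 ι 𝕜 : Type*} [RCLike 𝕜] [Fintype ι] {𝓤 : ι → Type*}
    [MeasurableSpace Ω] [MeasurableSpace 𝓧] [∀ k, MeasurableSpace (𝓤 k)] {P : Measure Ω}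
    [IsProbabilityMeasure P] {ν : Measure 𝓧} {ρ : ∀ k, Measure (𝓤 k)} {X : Ω → 𝓧}
    {U : ∀ k, Ω → 𝓤 k} (hX : HasLaw X ν P) (hU : ∀ k, HasLaw (U k) (ρ k) P)
    (hU_indep : iIndepFun U P) (hXU : IndepFun X (fun ω k => U k ω) P)
    {h : 𝓧 → 𝕜} {F : ∀ k, 𝓧 → 𝓤 k → 𝕜}
    (hF : Integrable (fun q : 𝓧 × (∀ k, 𝓤 k) => h q.1 * ∏ k, F k q.1 (q.2 k))
      (ν.prod (Measure.pi ρ))) :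
    ∫ ω, h (X ω) * ∏ k, F k (X ω) (U k ω) ∂P = ∫ x, h x * ∏ k, ∫ u, F k x u ∂ρ k ∂ν := by
  have : IsProbabilityMeasure ν := hX.isProbabilityMeasure_iff.1 inferInstance
  have (k : ι) : IsProbabilityMeasure (ρ k) := (hU k).isProbabilityMeasure_iff.1 inferInstance
  have hlaw : HasLaw (fun ω => (X ω, fun k => U k ω)) (ν.prod (Measure.pi ρ)) P :=
    (indepFun_iff_hasLaw_prodMk_prod hX (hU_indep.hasLaw_pi hU)).1 hXU
  calc ∫ ω, h (X ω) * ∏ k, F k (X ω) (U k ω) ∂P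
      = ∫ q, h q.1 * ∏ k, F k q.1 (q.2 k) ∂ν.prod (Measure.pi ρ) :=
        hlaw.integral_comp hF.aestronglyMeasurable
    _ = ∫ x, ∫ u, h x * ∏ k, F k x (u k) ∂Measure.pi ρ ∂ν := integral_prod _ hF
    _ = ∫ x, h x * ∏ k, ∫ u, F k x u ∂ρ k ∂ν := by
        simp only [integral_const_mul, integral_fintype_prod_eq_prod]

/-- The De Finetti representation of `n` Curie–Weiss spins: the parameter `V` has the De Finetti
law and is independent of the independent uniform variables `U k`. The law of `V` is prescribed
for `n ≥ 1` only, as the De Finetti density is not integrable for `n = 0`. -/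
structure IsDeFinettiCoupling {Ω : Type*} [MeasurableSpace Ω] {n : ℕ} (β : ℝ)
    (U : Fin n → Ω → ℝ) (V : Ω → ℝ) (P : Measure Ω) : Prop where
  hasLaw_uniform : ∀ k, HasLaw (U k) (volume.restrict (Set.Icc (0 : ℝ) 1)) P
  iIndepFun_uniform : iIndepFun U P
  aemeasurable_param : AEMeasurable V P
  hasLaw_param : 0 < n → HasLaw V (deFinettiMeasure n β) P
  indepFun : IndepFun V (fun ω k => U k ω) P

namespace IsDeFinettiCoupling

variable {Ω : Type*} [MeasurableSpace Ω] {P : Measure Ω} {n : ℕ} {β : ℝ} {U : Fin n → Ω → ℝ}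
  {V : Ω → ℝ}

lemma aemeasurable_spin (hUV : IsDeFinettiCoupling β U V P) (k : Fin n) :
    AEMeasurable (fun ω => spin (U k ω) (V ω)) P :=
  measurable_spin.comp_aemeasurable
    ((hUV.hasLaw_uniform k).aemeasurable.prodMk hUV.aemeasurable_param)

lemma aemeasurable_magnetisation (hUV : IsDeFinettiCoupling β U V P) :
    AEMeasurable (fun ω => magnetisation (fun k => U k ω) (V ω)) P :=
  Finset.aemeasurable_fun_sum _ fun k _ => hUV.aemeasurable_spin k

lemma integral_mul_prod_eq [IsProbabilityMeasure P] (hUV : IsDeFinettiCoupling β U V P)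
    (hn : 0 < n) {h : ℝ → ℂ} {F : Fin n → ℝ → ℝ → ℂ} (hh : Measurable h)
    (hh_le : ∀ p, ‖h p‖ ≤ 1) (hF : ∀ k, Measurable fun q : ℝ × ℝ => F k q.1 q.2)
    (hF_le : ∀ k p x, ‖F k p x‖ ≤ 1) :
    ∫ ω, h (V ω) * ∏ k, F k (V ω) (spin (U k ω) (V ω)) ∂P =
      ∫ p, h p * ∏ k, (∫ u in Set.Icc (0 : ℝ) 1, F k p (spin u p)) ∂deFinettiMeasure n β := by
  have hV := hUV.hasLaw_param hn
  have : IsProbabilityMeasure (deFinettiMeasure n β) := hV.isProbabilityMeasure_iff.1 inferInstance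
  refine integral_mul_prod_of_indepFun hV hUV.hasLaw_uniform hUV.iIndepFun_uniform hUV.indepFun
    (F := fun k p u => F k p (spin u p)) (Integrable.of_bound (C := 1) ?_ (ae_of_all _ fun q => ?_))
  · have hspin : ∀ k, Measurable fun q : ℝ × (Fin n → ℝ) => F k q.1 (spin (q.2 k) q.1) := fun k =>
      (hF k).comp (measurable_fst.prodMk (measurable_spin.comp
        (f := fun q : ℝ × (Fin n → ℝ) => (q.2 k, q.1)) (by fun_prop)))
    exact ((hh.comp measurable_fst).mul
      (Finset.measurable_fun_prod _ fun k _ => hspin k)).aestronglyMeasurable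
  · rw [norm_mul, norm_prod]
    exact mul_le_one₀ (hh_le _) (by positivity)
      (Finset.prod_le_one (fun k _ => norm_nonneg _) fun k _ => hF_le k _ _)

end IsDeFinettiCoupling

end Coupling

section CurieWeissLaw

lemma cosh_mul_one_add_tanh_mul_sign {x : ℝ} (hx : x = 1 ∨ x = -1) (y : ℝ) :
    Real.cosh y * (1 + Real.tanh y * x) = Real.exp (y * x) := by
  rw [mul_add, mul_one, ← mul_assoc, Real.tanh_eq_sinh_div_cosh,
    mul_div_cancel₀ _ (Real.cosh_pos y).ne']
  rcases hx with rfl | rfl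
  · rw [mul_one, mul_one, Real.cosh_add_sinh]
  · rw [mul_neg_one, mul_neg_one, ← sub_eq_add_neg, Real.cosh_sub_sinh]

lemma hsWeight_pow_mul_prod_sign {n : ℕ} {β : ℝ} (hβ : 0 < β) (hn : 0 < n) {x : Fin n → ℝ}
    (hx : ∀ k, x k = 1 ∨ x k = -1) (y : ℝ) :
    hsWeight β y ^ n * ∏ k, (1 + Real.tanh y * x k) =
      Real.exp (-(n / (2 * β)) * (y - β * (∑ k, x k) / n) ^ 2) *
        Real.exp (β / (2 * n) * (∑ k, x k) ^ 2) := by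
  have hprod : Real.cosh y ^ n * ∏ k, (1 + Real.tanh y * x k) = Real.exp (y * ∑ k, x k) := by
    rw [Finset.mul_sum, Real.exp_sum, ← Fin.prod_const, ← Finset.prod_mul_distrib]
    exact Finset.prod_congr rfl fun k _ => cosh_mul_one_add_tanh_mul_sign (hx k) y
  rw [hsWeight, mul_pow, mul_assoc, hprod, ← Real.exp_nat_mul, ← Real.exp_add, ← Real.exp_add]
  congr 1
  field_simp
  ring

lemma integral_prod_sign_deFinettiMeasure {n : ℕ} {β : ℝ} (hβ : 0 < β) (hn : 0 < n)
    {x : Fin n → ℝ} (hx : ∀ k, x k = 1 ∨ x k = -1) :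
    ∫ p, ∏ k, (1 + (2 * p - 1) * x k) ∂deFinettiMeasure n β =
      ((∫ y, hsWeight β y ^ n)⁻¹ * ∫ y, Real.exp (-(n / (2 * β)) * y ^ 2)) *
        Real.exp (β / (2 * n) * (∑ k, x k) ^ 2) := by
  have harg : ∀ y, 2 * ((1 + Real.tanh y) / 2) - 1 = Real.tanh y := fun y => by ring
  simp only [integral_deFinettiMeasure, harg, smul_eq_mul, hsWeight_pow_mul_prod_sign hβ hn hx,
    integral_mul_const, mul_assoc]
  rw [integral_sub_right_eq_self (fun y => Real.exp (-(n / (2 * β)) * y ^ 2))]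

lemma prod_integral_comp_spin {n : ℕ} (f : Fin n → ℝ → ℂ) {p : ℝ} (hp : p ∈ Set.Icc (0 : ℝ) 1) :
    ∏ k, ∫ u in Set.Icc (0 : ℝ) 1, f k (spin u p) =
      ∫ x, (∏ k, (1 + (2 * p - 1) * x k)) • ∏ k, f k (x k)
        ∂Measure.pi fun _ : Fin n => signLaw := by
  simp only [integral_comp_spin_eq_integral_signLaw (f _) hp]
  rw [← integral_fintype_prod_eq_prod (fun k x => (1 + (2 * p - 1) * x) • f k x)]
  simp only [Complex.real_smul, Finset.prod_mul_distrib, Complex.ofReal_prod]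

lemma integrable_prod_sign_smul {n : ℕ} {ν : Measure ℝ} [IsFiniteMeasure ν]
    (hν : ∀ᵐ p ∂ν, p ∈ Set.Icc (0 : ℝ) 1) {g : (Fin n → ℝ) → ℂ} (hg : Measurable g)
    (hg_le : ∀ x, ‖g x‖ ≤ 1) :
    Integrable (fun q : ℝ × (Fin n → ℝ) => (∏ k, (1 + (2 * q.1 - 1) * q.2 k)) • g q.2)
      (ν.prod (Measure.pi fun _ : Fin n => signLaw)) := by
  refine Integrable.of_bound (C := 2 ^ n) (by fun_prop) ?_
  filter_upwards [Measure.quasiMeasurePreserving_fst.ae hν,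
    Measure.quasiMeasurePreserving_snd.ae ae_pi_signLaw] with q hp hx
  have hfactor : ∀ k, ‖1 + (2 * q.1 - 1) * q.2 k‖ ≤ 2 := fun k => by
    rw [Real.norm_eq_abs, abs_le]
    rcases hx k with h | h <;> rw [h] <;> constructor <;> linarith [hp.1, hp.2]
  calc ‖(∏ k, (1 + (2 * q.1 - 1) * q.2 k)) • g q.2‖
      = (∏ k, ‖1 + (2 * q.1 - 1) * q.2 k‖) * ‖g q.2‖ := by rw [norm_smul, norm_prod]
    _ ≤ (∏ _k : Fin n, 2) * 1 := by
        gcongr with k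
        exacts [hfactor k, hg_le _]
    _ = 2 ^ n := by rw [mul_one, Fin.prod_const]

lemma integral_prod_integral_comp_spin {n : ℕ} {ν : Measure ℝ} [IsFiniteMeasure ν]
    (hν : ∀ᵐ p ∂ν, p ∈ Set.Icc (0 : ℝ) 1) {f : Fin n → ℝ → ℂ} (hf : ∀ k, Measurable (f k))
    (hf_le : ∀ k x, ‖f k x‖ ≤ 1) :
    ∫ p, ∏ k, (∫ u in Set.Icc (0 : ℝ) 1, f k (spin u p)) ∂ν =
      ∫ x, (∫ p, ∏ k, (1 + (2 * p - 1) * x k) ∂ν) • ∏ k, f k (x k)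
        ∂Measure.pi fun _ : Fin n => signLaw := by
  have hg : Measurable fun x : Fin n → ℝ => ∏ k, f k (x k) := by fun_prop
  have hg_le : ∀ x : Fin n → ℝ, ‖∏ k, f k (x k)‖ ≤ 1 := fun x => by
    rw [norm_prod]
    exact Finset.prod_le_one (fun k _ => norm_nonneg _) fun k _ => hf_le k _
  rw [integral_congr_ae (hν.mono fun p hp => prod_integral_comp_spin f hp),
    integral_integral_swap (integrable_prod_sign_smul hν hg hg_le)]
  simp only [integral_smul_const]

lemma integral_curieWeissLaw {n : ℕ} {β : ℝ} (hβ : 0 < β) (hn : 0 < n)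
    {f : Fin n → ℝ → ℂ} (hf : ∀ k, Measurable (f k)) (hf_le : ∀ k x, ‖f k x‖ ≤ 1) :
    ∫ x, ∏ k, f k (x k) ∂curieWeissLaw n β =
      ∫ p, ∏ k, (∫ u in Set.Icc (0 : ℝ) 1, f k (spin u p)) ∂deFinettiMeasure n β := by
  have := isProbabilityMeasure_deFinettiMeasure hβ hn.ne'
  set Q := Measure.pi fun _ : Fin n => signLaw
  let e : (Fin n → ℝ) → ℝ := fun x => Real.exp (β / (2 * n) * (∑ k, x k) ^ 2)
  obtain ⟨K, hK⟩ : ∃ K : ℝ, ∀ x : Fin n → ℝ, (∀ k, x k = 1 ∨ x k = -1) →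
      ∫ p, ∏ k, (1 + (2 * p - 1) * x k) ∂deFinettiMeasure n β = K * e x :=
    ⟨_, fun _ => integral_prod_sign_deFinettiMeasure hβ hn⟩
  have hmix : ∀ f : Fin n → ℝ → ℂ, (∀ k, Measurable (f k)) → (∀ k x, ‖f k x‖ ≤ 1) →
      ∫ p, ∏ k, (∫ u in Set.Icc (0 : ℝ) 1, f k (spin u p)) ∂deFinettiMeasure n β =
        K • ∫ x, e x • ∏ k, f k (x k) ∂Q := by
    intro f hf hf_le
    rw [integral_prod_integral_comp_spin (ae_mem_Icc_deFinettiMeasure n β) hf hf_le,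
      ← integral_smul]
    exact integral_congr_ae <| ae_pi_signLaw.mono fun x hx => by simp only [hK x hx, mul_smul]
  -- The constant need not be computed: the test functions `f k = 1` identify it.
  have hK_inv : K = (∫ x, e x ∂Q)⁻¹ := by
    have hone := hmix (fun _ _ => 1) (fun _ => measurable_const) (by simp)
    simp only [integral_const, probReal_univ, one_smul, Finset.prod_const_one, Complex.real_smul,
      mul_one, integral_complex_ofReal] at hone
    exact eq_inv_of_mul_eq_one_left (mod_cast hone.symm)
  rw [hmix f hf hf_le, curieWeissLaw, integral_tilted, hK_inv, ← integral_smul]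
  simp only [← mul_smul, e, div_eq_inv_mul, Q]

lemma isProbabilityMeasure_curieWeissLaw (n : ℕ) (β : ℝ) :
    IsProbabilityMeasure (curieWeissLaw n β) := by
  refine isProbabilityMeasure_tilted (Integrable.of_bound (C := Real.exp (|β / (2 * n)| * n ^ 2))
    (by fun_prop) (ae_pi_signLaw.mono fun x hx => ?_))
  have hsum : |∑ k, x k| ≤ n := by
    refine (Finset.abs_sum_le_sum_abs _ _).trans_eq ?_
    have habs : ∀ k, |x k| = 1 := fun k => by rcases hx k with h | h <;> simp [h]
    simp [habs]
  rw [Real.norm_eq_abs, Real.abs_exp, Real.exp_le_exp]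
  refine (le_abs_self _).trans ?_
  rw [abs_mul, abs_pow]
  gcongr

lemma eq_of_integral_prod_cexp_eq {ι : Type*} [Fintype ι] {μ ν : Measure (ι → ℝ)}
    [IsFiniteMeasure μ] [IsFiniteMeasure ν]
    (h : ∀ a : ι → ℝ, ∫ x, ∏ k, Complex.exp (↑(a k * x k) * Complex.I) ∂μ =
      ∫ x, ∏ k, Complex.exp (↑(a k * x k) * Complex.I) ∂ν) : μ = ν := by
  classical
  have hcharFunDual : ∀ (ρ : Measure (ι → ℝ)) (L : StrongDual ℝ (ι → ℝ)), charFunDual ρ L =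
      ∫ x, ∏ k, Complex.exp (↑(L (Pi.single k 1) * x k) * Complex.I) ∂ρ := by
    intro ρ L
    rw [charFunDual_apply]
    congr 1 with x
    have hL : L x = ∑ k, L (Pi.single k 1) * x k := by
      conv_lhs => rw [pi_eq_sum_univ' x]
      simp [mul_comm]
    rw [hL, ← Complex.exp_sum, Complex.ofReal_sum, Finset.sum_mul]
  exact Measure.ext_of_charFunDual (funext fun L => by
    rw [hcharFunDual, hcharFunDual, h])

theorem IsDeFinettiCoupling.hasLaw_spins {Ω : Type*} [MeasurableSpace Ω] {P : Measure Ω}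
    [IsProbabilityMeasure P] {n : ℕ} {β : ℝ} {U : Fin n → Ω → ℝ} {V : Ω → ℝ}
    (hUV : IsDeFinettiCoupling β U V P) (hβ : 0 < β) (hn : 0 < n) :
    HasLaw (fun ω k => spin (U k ω) (V ω)) (curieWeissLaw n β) P := by
  have hspins : AEMeasurable (fun ω k => spin (U k ω) (V ω)) P :=
    aemeasurable_pi_lambda _ hUV.aemeasurable_spin
  have := isProbabilityMeasure_curieWeissLaw n β
  refine ⟨hspins, eq_of_integral_prod_cexp_eq fun a => ?_⟩
  have hexp : ∀ k, Measurable fun x : ℝ => Complex.exp (↑(a k * x) * Complex.I) := by fun_prop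
  have hexp_le : ∀ k x, ‖Complex.exp (↑(a k * x) * Complex.I)‖ ≤ 1 := fun k x =>
    (Complex.norm_exp_ofReal_mul_I _).le
  rw [integral_map hspins (by fun_prop : Measurable _).aestronglyMeasurable,
    integral_curieWeissLaw hβ hn hexp hexp_le]
  simpa only [one_mul] using hUV.integral_mul_prod_eq hn (h := fun _ => 1) measurable_const
    (by simp) (F := fun k _ x => Complex.exp (↑(a k * x) * Complex.I))
    (fun k => (hexp k).comp measurable_snd) fun k _ x => hexp_le k x

end CurieWeissLaw

section CharacteristicFunction

lemma norm_pow_sub_pow_le {R : Type*} [NormedRing R] [NormOneClass R] {z w : R} (hz : ‖z‖ ≤ 1)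
    (hw : ‖w‖ ≤ 1) (n : ℕ) : ‖z ^ n - w ^ n‖ ≤ n * ‖z - w‖ := by
  induction n with
  | zero => simp
  | succ n ih =>
    calc ‖z ^ (n + 1) - w ^ (n + 1)‖ = ‖z ^ n * (z - w) + (z ^ n - w ^ n) * w‖ := by
          congr 1
          noncomm_ring
      _ ≤ ‖z ^ n‖ * ‖z - w‖ + ‖z ^ n - w ^ n‖ * ‖w‖ :=
          norm_add_le_of_le (norm_mul_le _ _) (norm_mul_le _ _)
      _ ≤ 1 * ‖z - w‖ + n * ‖z - w‖ * 1 := by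
          gcongr
          exact (norm_pow_le z n).trans (pow_le_one₀ (norm_nonneg z) hz)
      _ = (n + 1 : ℕ) * ‖z - w‖ := by
          push_cast
          ring

lemma abs_exp_sub_exp_le {x y : ℝ} (hx : x ≤ 0) (hy : y ≤ 0) :
    |Real.exp x - Real.exp y| ≤ |x - y| := by
  simpa only [one_mul, Real.norm_eq_abs] using
    (convex_Iic (0 : ℝ)).norm_image_sub_le_of_norm_deriv_le (f := Real.exp) (C := 1)
      (fun z _ => Real.differentiableAt_exp)
      (fun z hz => by simpa [Real.deriv_exp] using hz) hy hx

lemma norm_cexp_mul_I_sub_le {x : ℝ} (hx : |x| ≤ 1) :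
    ‖Complex.exp (x * Complex.I) - (1 + x * Complex.I - (x ^ 2 / 2 : ℝ))‖ ≤ 2 / 9 * |x| ^ 3 := by
  have hnorm : ‖(x : ℂ) * Complex.I‖ = |x| := by simp
  have hbound := Complex.exp_bound (x := x * Complex.I) (hnorm.trans_le hx) (n := 3) (by norm_num)
  have htaylor : ∑ m ∈ Finset.range 3, ((x : ℂ) * Complex.I) ^ m / (m.factorial : ℂ) =
      1 + x * Complex.I - (x ^ 2 / 2 : ℝ) := by
    simp [Finset.sum_range_succ, mul_pow]
    ring
  rw [htaylor, hnorm] at hbound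
  refine hbound.trans_eq ?_
  norm_num [Nat.factorial]
  ring

variable {Ω : Type*} [MeasurableSpace Ω] {P : Measure Ω} [IsProbabilityMeasure P] {X : Ω → ℝ}
  {K r : ℝ}

lemma integral_sq_le_sq_of_abs_le (hXK : ∀ᵐ ω ∂P, |X ω| ≤ K) : ∫ ω, X ω ^ 2 ∂P ≤ K ^ 2 := by
  have hsq : ∀ᵐ ω ∂P, ‖X ω ^ 2‖ ≤ K ^ 2 := hXK.mono fun ω hω => by
    rw [norm_pow]
    exact pow_le_pow_left₀ (norm_nonneg _) hω 2
  simpa using (le_abs_self _).trans (norm_integral_le_of_norm_le_const hsq)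

lemma norm_integral_cexp_sub_taylor_le (hX : AEMeasurable X P) (hXK : ∀ᵐ ω ∂P, |X ω| ≤ K)
    (hX0 : ∫ ω, X ω ∂P = 0) (hr : |r| * K ≤ 1) :
    ‖∫ ω, Complex.exp (↑(r * X ω) * Complex.I) ∂P - (1 - r ^ 2 * (∫ ω, X ω ^ 2 ∂P) / 2 : ℝ)‖ ≤
      2 / 9 * (|r| * K) ^ 3 := by
  have hrX : ∀ᵐ ω ∂P, |r * X ω| ≤ |r| * K := hXK.mono fun ω hω => by
    rw [abs_mul]
    gcongr
  have hX_int : Integrable X P := .of_bound hX.aestronglyMeasurable K hXK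
  have hX2_int : Integrable (fun ω => X ω ^ 2) P := .of_bound (by fun_prop) (K ^ 2)
    (hXK.mono fun ω hω => by
      rw [norm_pow]
      exact pow_le_pow_left₀ (norm_nonneg _) hω 2)
  have hexp_int : Integrable (fun ω => Complex.exp (↑(r * X ω) * Complex.I)) P :=
    .of_bound (by fun_prop) 1 (ae_of_all _ fun ω => (Complex.norm_exp_ofReal_mul_I _).le)
  have hlin_int : Integrable (fun ω => (↑(r * X ω) : ℂ) * Complex.I) P :=
    (hX_int.const_mul r).ofReal.mul_const _
  have haff_int : Integrable (fun ω => 1 + (↑(r * X ω) : ℂ) * Complex.I) P :=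
    (integrable_const _).add hlin_int
  have hquad_int : Integrable (fun ω => (((r * X ω) ^ 2 / 2 : ℝ) : ℂ)) P := by
    simp only [mul_pow]
    exact ((hX2_int.const_mul (r ^ 2)).div_const 2).ofReal
  have hpoly_int : Integrable
      (fun ω => 1 + (↑(r * X ω) : ℂ) * Complex.I - ((r * X ω) ^ 2 / 2 : ℝ)) P :=
    haff_int.sub hquad_int
  have htaylor : ∫ ω, (1 + (↑(r * X ω) : ℂ) * Complex.I - ((r * X ω) ^ 2 / 2 : ℝ)) ∂P =
      (1 - r ^ 2 * (∫ ω, X ω ^ 2 ∂P) / 2 : ℝ) := by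
    rw [integral_sub haff_int hquad_int,
      integral_add (integrable_const _) hlin_int, integral_mul_const, integral_complex_ofReal,
      integral_complex_ofReal, integral_const_mul, hX0, integral_div]
    simp only [mul_pow, integral_const_mul, integral_const, probReal_univ]
    simp
  rw [← htaylor, ← integral_sub hexp_int hpoly_int]
  refine (norm_integral_le_of_norm_le_const (C := 2 / 9 * (|r| * K) ^ 3)
    (hrX.mono fun ω hω => ?_)).trans_eq (by simp)
  exact (norm_cexp_mul_I_sub_le (hω.trans hr)).trans (by gcongr)

lemma norm_integral_cexp_sub_exp_le (hX : AEMeasurable X P) (hXK : ∀ᵐ ω ∂P, |X ω| ≤ K)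
    (hX0 : ∫ ω, X ω ∂P = 0) (hr : |r| * K ≤ 1) :
    ‖∫ ω, Complex.exp (↑(r * X ω) * Complex.I) ∂P -
      Real.exp (-(r ^ 2 * (∫ ω, X ω ^ 2 ∂P) / 2))‖ ≤ (|r| * K) ^ 3 := by
  have hK : 0 ≤ K := hXK.exists.elim fun ω => (abs_nonneg _).trans
  set s := |r| * K with hs
  have hs0 : 0 ≤ s := by positivity
  set q := r ^ 2 * (∫ ω, X ω ^ 2 ∂P) / 2 with hq
  have hq0 : 0 ≤ q := by positivity
  have hqs : q ≤ s ^ 2 / 2 := by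
    rw [hq, hs, mul_pow, sq_abs]
    gcongr
    exact integral_sq_le_sq_of_abs_le hXK
  have hexp : |Real.exp (-q) - (1 - q)| ≤ s ^ 3 / 4 := by
    calc |Real.exp (-q) - (1 - q)| = |Real.exp (-q) - 1 - -q| := by ring_nf
      _ ≤ (-q) ^ 2 := Real.abs_exp_sub_one_sub_id_le (by
          rw [abs_neg, abs_of_nonneg hq0]
          nlinarith)
      _ ≤ (s ^ 2 / 2) ^ 2 := by
          rw [neg_sq]
          gcongr
      _ ≤ s ^ 3 / 4 := by nlinarith [pow_nonneg hs0 3]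
  calc _ ≤ _ := norm_sub_le_norm_sub_add_norm_sub _ ((1 - q : ℝ) : ℂ) _
    _ ≤ 2 / 9 * s ^ 3 + s ^ 3 / 4 := by
        refine add_le_add (norm_integral_cexp_sub_taylor_le hX hXK hX0 hr) ?_
        rw [norm_sub_rev, ← Complex.ofReal_sub, Complex.norm_real]
        exact hexp
    _ ≤ s ^ 3 := by linarith [pow_nonneg hs0 3]

lemma norm_integral_cexp_pow_sub_exp_le (hX : AEMeasurable X P) (hXK : ∀ᵐ ω ∂P, |X ω| ≤ K)
    (hX0 : ∫ ω, X ω ∂P = 0) (hr : |r| * K ≤ 1) {v : ℝ} (hv : 0 ≤ v) (n : ℕ) :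
    ‖(∫ ω, Complex.exp (↑(r * X ω) * Complex.I) ∂P) ^ n -
      Real.exp (-(v * (∫ ω, X ω ^ 2 ∂P) / 2))‖ ≤
      n * (|r| * K) ^ 3 + |n * r ^ 2 - v| * ((∫ ω, X ω ^ 2 ∂P) / 2) := by
  set φ := ∫ ω, Complex.exp (↑(r * X ω) * Complex.I) ∂P
  set q := (∫ ω, X ω ^ 2 ∂P) / 2 with hq
  have hq0 : 0 ≤ q := by positivity
  have hφ : ‖φ‖ ≤ 1 := (norm_integral_le_of_norm_le_const (C := 1)
    (ae_of_all _ fun ω => (Complex.norm_exp_ofReal_mul_I _).le)).trans_eq (by simp)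
  have hgauss : ‖(Real.exp (-(r ^ 2 * q)) : ℂ)‖ ≤ 1 := by
    rw [Complex.norm_real, Real.norm_of_nonneg (Real.exp_pos _).le, Real.exp_le_one_iff,
      neg_nonpos]
    positivity
  have hsingle : ‖φ - (Real.exp (-(r ^ 2 * q)) : ℂ)‖ ≤ (|r| * K) ^ 3 := by
    simpa only [hq, mul_div_assoc] using norm_integral_cexp_sub_exp_le hX hXK hX0 hr
  rw [mul_div_assoc, ← hq]
  calc _ ≤ _ := norm_sub_le_norm_sub_add_norm_sub _ ((Real.exp (-(r ^ 2 * q)) : ℂ) ^ n) _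
    _ ≤ n * (|r| * K) ^ 3 + |n * r ^ 2 - v| * q := by
        refine add_le_add ((norm_pow_sub_pow_le hφ hgauss n).trans (by gcongr)) ?_
        rw [← Complex.ofReal_pow, ← Real.exp_nat_mul, ← Complex.ofReal_sub, Complex.norm_real,
          Real.norm_eq_abs]
        refine (abs_exp_sub_exp_le ?_ ?_).trans_eq ?_
        · rw [mul_neg, neg_nonpos]
          positivity
        · rw [neg_nonpos]
          positivity
        · rw [← abs_of_nonneg hq0, ← abs_mul, abs_of_nonneg hq0, abs_sub_comm]
          congr 1
          ring

end CharacteristicFunction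

section Fluctuations

/-- The characteristic function of the centred spin with mean `2 * p - 1`. -/
noncomputable def spinCharFun (r p : ℝ) : ℂ :=
  ∫ u in Set.Icc (0 : ℝ) 1, Complex.exp (↑(r * (spin u p - (2 * p - 1))) * Complex.I)

variable {n : ℕ} {β r p v : ℝ}

lemma stronglyMeasurable_spinCharFun (r : ℝ) : StronglyMeasurable (spinCharFun r) := by
  have hspin := measurable_spin
  have hexp : Measurable fun q : ℝ × ℝ =>
      Complex.exp (↑(r * (spin q.2 q.1 - (2 * q.1 - 1))) * Complex.I) := by
    have := hspin.comp measurable_swap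
    fun_prop
  exact hexp.stronglyMeasurable.integral_prod_right

lemma norm_spinCharFun_le_one (r p : ℝ) : ‖spinCharFun r p‖ ≤ 1 :=
  (norm_integral_le_of_norm_le_const (C := 1)
    (ae_of_all _ fun u => (Complex.norm_exp_ofReal_mul_I _).le)).trans_eq (by simp)

lemma norm_spinCharFun_pow_sub_exp_le (hp : p ∈ Set.Icc (0 : ℝ) 1) (hr : |r| * 2 ≤ 1)
    (hv : 0 ≤ v) (n : ℕ) :
    ‖spinCharFun r p ^ n - Real.exp (-(v * (1 - (2 * p - 1) ^ 2) / 2))‖ ≤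
      n * (|r| * 2) ^ 3 + |n * r ^ 2 - v| := by
  have hmeas : Measurable fun u => spin u p - (2 * p - 1) :=
    (measurable_spin.comp measurable_prodMk_right).sub_const _
  have hbound : ∀ u, |spin u p - (2 * p - 1)| ≤ 2 := fun u => by
    rw [abs_le]
    rcases spin_eq_one_or u p with h | h <;> rw [h] <;> constructor <;> linarith [hp.1, hp.2]
  have hmean : ∫ u in Set.Icc (0 : ℝ) 1, (spin u p - (2 * p - 1)) = 0 := by
    rw [integral_comp_spin (fun x => x - (2 * p - 1)) hp, smul_eq_mul, smul_eq_mul]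
    ring
  have hvar : ∫ u in Set.Icc (0 : ℝ) 1, (spin u p - (2 * p - 1)) ^ 2 = 1 - (2 * p - 1) ^ 2 := by
    rw [integral_comp_spin (fun x => (x - (2 * p - 1)) ^ 2) hp, smul_eq_mul, smul_eq_mul]
    ring
  have h := norm_integral_cexp_pow_sub_exp_le hmeas.aemeasurable (ae_of_all _ hbound) hmean hr hv n
  rw [hvar] at h
  refine h.trans (add_le_add_right (mul_le_of_le_one_right (abs_nonneg _) ?_) _)
  linarith [sq_nonneg (2 * p - 1)]

lemma IsDeFinettiCoupling.integral_cexp_magnetisation {Ω : Type*} [MeasurableSpace Ω]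
    {P : Measure Ω} [IsProbabilityMeasure P] {U : Fin n → Ω → ℝ} {V : Ω → ℝ}
    (hUV : IsDeFinettiCoupling β U V P) (hn : 0 < n) (r b : ℝ) :
    ∫ ω, Complex.exp (↑(r * (magnetisation (fun k => U k ω) (V ω) - n * (2 * V ω - 1)) +
        b * (2 * V ω - 1)) * Complex.I) ∂P =
      ∫ p, Complex.exp (↑(b * (2 * p - 1)) * Complex.I) * spinCharFun r p ^ n
        ∂deFinettiMeasure n β := by
  have hfactor : ∀ ω,
      Complex.exp (↑(r * (magnetisation (fun k => U k ω) (V ω) - n * (2 * V ω - 1)) +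
        b * (2 * V ω - 1)) * Complex.I) = Complex.exp (↑(b * (2 * V ω - 1)) * Complex.I) *
        ∏ k, Complex.exp (↑(r * (spin (U k ω) (V ω) - (2 * V ω - 1))) * Complex.I) := by
    intro ω
    rw [← Complex.exp_sum, ← Complex.exp_add, ← Finset.sum_mul, ← add_mul, ← Complex.ofReal_sum,
      ← Complex.ofReal_add, ← Finset.mul_sum, Finset.sum_sub_distrib, Fin.sum_const, nsmul_eq_mul,
      add_comm, magnetisation]
  simp only [hfactor]
  rw [hUV.integral_mul_prod_eq hn (h := fun p => Complex.exp (↑(b * (2 * p - 1)) * Complex.I))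
    (F := fun _ p x => Complex.exp (↑(r * (x - (2 * p - 1))) * Complex.I)) (by fun_prop)
    (fun _ => (Complex.norm_exp_ofReal_mul_I _).le) (fun _ => by fun_prop)
    fun _ _ _ => (Complex.norm_exp_ofReal_mul_I _).le]
  simp only [Fin.prod_const, spinCharFun]

-- The absolute value is inactive on `[0, 1]`: it keeps the limiting integrand bounded on `ℝ`.
lemma norm_integral_spinCharFun_pow_sub_le (hβ : 0 < β) (hn : 0 < n) (hr : |r| * 2 ≤ 1)
    (hv : 0 ≤ v) {g : ℝ → ℂ} (hg : Measurable g) (hg_le : ∀ p, ‖g p‖ ≤ 1) :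
    ‖∫ p, g p * spinCharFun r p ^ n ∂deFinettiMeasure n β -
        ∫ p, g p * Real.exp (-(v * |1 - (2 * p - 1) ^ 2| / 2)) ∂deFinettiMeasure n β‖ ≤
      n * (|r| * 2) ^ 3 + |n * r ^ 2 - v| := by
  have := isProbabilityMeasure_deFinettiMeasure hβ hn.ne'
  have hspin := (stronglyMeasurable_spinCharFun r).measurable
  have hspin_int : Integrable (fun p => g p * spinCharFun r p ^ n) (deFinettiMeasure n β) := by
    refine .of_bound (by fun_prop) 1 (ae_of_all _ fun p => ?_)
    rw [norm_mul, norm_pow]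
    exact mul_le_one₀ (hg_le p) (by positivity)
      (pow_le_one₀ (norm_nonneg _) (norm_spinCharFun_le_one r p))
  have hgauss_int : Integrable (fun p => g p * Real.exp (-(v * |1 - (2 * p - 1) ^ 2| / 2)))
      (deFinettiMeasure n β) := by
    refine .of_bound (by fun_prop) 1 (ae_of_all _ fun p => ?_)
    rw [norm_mul, Complex.norm_real, Real.norm_of_nonneg (Real.exp_pos _).le]
    exact mul_le_one₀ (hg_le p) (Real.exp_pos _).le
      (Real.exp_le_one_iff.2 (neg_nonpos.2 (by positivity)))
  rw [← integral_sub hspin_int hgauss_int]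
  refine (norm_integral_le_of_norm_le_const (C := n * (|r| * 2) ^ 3 + |n * r ^ 2 - v|)
    ((ae_mem_Icc_deFinettiMeasure n β).mono fun p hp => ?_)).trans_eq (by simp)
  have hvar : 0 ≤ 1 - (2 * p - 1) ^ 2 := by nlinarith [hp.1, hp.2]
  rw [abs_of_nonneg hvar, ← mul_sub, norm_mul]
  exact (mul_le_of_le_one_left (norm_nonneg _) (hg_le p)).trans
    (norm_spinCharFun_pow_sub_exp_le hp hr hv n)

lemma tendsto_zero_of_tendsto_natCast_mul_sq {r : ℕ → ℝ} {v : ℝ}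
    (hr : Tendsto (fun n : ℕ => n * r n ^ 2) atTop (𝓝 v)) : Tendsto r atTop (𝓝 0) := by
  have hsq : Tendsto (fun n => r n ^ 2) atTop (𝓝 0) := by
    refine ((hr.mul tendsto_inv_atTop_nhds_zero_nat).congr' ?_).trans_eq (by rw [mul_zero])
    filter_upwards [eventually_ne_atTop 0] with n hn
    field_simp
  refine (tendsto_zero_iff_abs_tendsto_zero r).2 ?_
  simpa [Function.comp_def, Real.sqrt_sq_eq_abs] using hsq.sqrt

theorem tendsto_integral_spinCharFun_pow {t : ℝ} (hβ : 0 < β) (ht_pos : 0 < t)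
    (ht : t = Real.tanh (β * t)) {r : ℕ → ℝ}
    (hr : Tendsto (fun n : ℕ => n * r n ^ 2) atTop (𝓝 v)) (b : ℝ) :
    Tendsto (fun n : ℕ => ∫ p, Complex.exp (↑(b * (2 * p - 1)) * Complex.I) *
      spinCharFun (r n) p ^ n ∂deFinettiMeasure n β) atTop
      (𝓝 (Real.exp (-(v * (1 - t ^ 2) / 2)) * Real.cos (b * t) : ℝ)) := by
  have hv : 0 ≤ v := ge_of_tendsto' hr fun n => by positivity
  have ht_lt : t < 1 := ht ▸ Real.tanh_lt_one _
  have hr0 := tendsto_zero_of_tendsto_natCast_mul_sq hr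
  let f : ℝ → ℂ := fun x =>
    Complex.exp (↑(b * x) * Complex.I) * Real.exp (-(v * |1 - x ^ 2| / 2))
  have hf_le : ∀ x, ‖f x‖ ≤ 1 := fun x => by
    rw [norm_mul, Complex.norm_exp_ofReal_mul_I, one_mul, Complex.norm_real,
      Real.norm_of_nonneg (Real.exp_pos _).le, Real.exp_le_one_iff, neg_nonpos]
    positivity
  have hf_lim : (1 / 2 : ℝ) • (f t + f (-t)) =
      (Real.exp (-(v * (1 - t ^ 2) / 2)) * Real.cos (b * t) : ℝ) := by
    have hvar : 0 ≤ 1 - t ^ 2 := by nlinarith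
    simp only [f, neg_sq, abs_of_nonneg hvar, mul_neg, Complex.real_smul]
    push_cast
    rw [Complex.cos]
    ring
  have herr : Tendsto (fun n : ℕ => n * (|r n| * 2) ^ 3 + |n * r n ^ 2 - v|) atTop (𝓝 0) := by
    have hcube := ((hr.mul hr0.abs).const_mul 8).congr (f₂ := fun n : ℕ => n * (|r n| * 2) ^ 3)
      fun n => by rw [← sq_abs]; ring
    simpa using hcube.add (hr.sub_const v).abs
  have hsmall : ∀ᶠ n in atTop, |r n| * 2 ≤ 1 :=
    (hr0.abs.mul_const 2).eventually_le_const (by simp)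
  refine (tendsto_iff_of_dist (squeeze_zero' (Eventually.of_forall fun _ => dist_nonneg) ?_
    herr)).2 (hf_lim ▸ tendsto_integral_deFinettiMeasure hβ ht_pos ht (by fun_prop) hf_le)
  filter_upwards [hsmall, eventually_gt_atTop 0] with n hrn hn
  rw [dist_eq_norm]
  exact norm_integral_spinCharFun_pow_sub_le hβ hn hrn hv (by fun_prop)
    fun p => (Complex.norm_exp_ofReal_mul_I _).le

end Fluctuations

section LimitLaw

variable {Ω : Type*} [MeasurableSpace Ω] {P : Measure Ω} {B : Ω → ℝ}

lemma integral_comp_prodMk_sign [IsProbabilityMeasure P] {𝓧 : Type*} [MeasurableSpace 𝓧] {X : Ω → 𝓧}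
    (hX : AEMeasurable X P) (hB : HasLaw B signLaw P) (hXB : IndepFun X B P) {F : 𝓧 × ℝ → ℂ}
    (hF : Measurable F) {C : ℝ} (hC : ∀ q, ‖F q‖ ≤ C) :
    ∫ ω, F (X ω, B ω) ∂P =
      (1 / 2 : ℝ) • (∫ ω, F (X ω, 1) ∂P + ∫ ω, F (X ω, -1) ∂P) := by
  have := Measure.isProbabilityMeasure_map hX
  have hlaw : HasLaw (fun ω => (X ω, B ω)) ((P.map X).prod signLaw) P :=
    (indepFun_iff_hasLaw_prodMk_prod ⟨hX, rfl⟩ hB).1 hXB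
  have hFs : ∀ s : ℝ, Measurable fun x => F (x, s) := fun s => hF.comp measurable_prodMk_right
  have hFs_int : ∀ s : ℝ, Integrable (fun x => F (x, s)) (P.map X) := fun s =>
    .of_bound (hFs s).aestronglyMeasurable C (ae_of_all _ fun x => hC _)
  calc ∫ ω, F (X ω, B ω) ∂P = ∫ q, F q ∂(P.map X).prod signLaw :=
        hlaw.integral_comp hF.aestronglyMeasurable
    _ = ∫ x, (1 / 2 : ℝ) • (F (x, 1) + F (x, -1)) ∂P.map X := by
        rw [integral_prod _ (.of_bound hF.aestronglyMeasurable C (ae_of_all _ hC))]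
        simp only [integral_signLaw]
    _ = (1 / 2 : ℝ) • (∫ ω, F (X ω, 1) ∂P + ∫ ω, F (X ω, -1) ∂P) := by
        rw [integral_smul, integral_add (hFs_int 1) (hFs_int (-1)),
          integral_map hX (hFs 1).aestronglyMeasurable,
          integral_map hX (hFs (-1)).aestronglyMeasurable]

lemma integral_cexp_sign (hB : HasLaw B signLaw P) (a : ℝ) :
    ∫ ω, Complex.exp (↑(a * B ω) * Complex.I) ∂P = Real.cos a := by
  have hlaw : ∫ ω, Complex.exp (↑(a * B ω) * Complex.I) ∂P =
      ∫ x : ℝ, Complex.exp (↑(a * x) * Complex.I) ∂signLaw :=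
    hB.integral_comp (f := fun x : ℝ => Complex.exp ((a * x : ℝ) * Complex.I)) (by fun_prop)
  rw [hlaw, integral_signLaw, Complex.real_smul]
  push_cast
  rw [Complex.cos]
  ring_nf

lemma integral_cexp_gaussian {G : Ω → ℝ} (hG : HasGaussianLaw G P) (hG0 : ∫ ω, G ω ∂P = 0)
    (a : ℝ) :
    ∫ ω, Complex.exp (↑(a * G ω) * Complex.I) ∂P =
      Real.exp (-(a ^ 2 * (∫ ω, G ω * G ω ∂P) / 2)) := by
  have hvar : Var[G; P] = ∫ ω, G ω * G ω ∂P := by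
    rw [variance_of_integral_eq_zero hG.aemeasurable hG0]
    simp [sq]
  have hcharFun : charFun (P.map G) a = ∫ ω, Complex.exp (↑(a * G ω) * Complex.I) ∂P := by
    rw [charFun_apply_real, integral_map hG.aemeasurable (by fun_prop)]
    simp only [Complex.ofReal_mul]
  rw [← hcharFun, hG.map_eq_gaussianReal, charFun_gaussianReal, hG0, ← hvar,
    Real.coe_toNNReal _ (variance_nonneg _ _)]
  push_cast
  ring_nf

lemma integral_cexp_gaussian_mixture [IsProbabilityMeasure P] {Gp Gm : Ω → ℝ}
    (hG : HasGaussianLaw (fun ω => (Gp ω, Gm ω)) P) (hB : HasLaw B signLaw P)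
    (hGB : IndepFun (fun ω => (Gp ω, Gm ω)) B P) (hGp0 : ∫ ω, Gp ω ∂P = 0)
    (hGm0 : ∫ ω, Gm ω ∂P = 0) {q : ℝ} (hGp2 : ∫ ω, Gp ω * Gp ω ∂P = q)
    (hGm2 : ∫ ω, Gm ω * Gm ω ∂P = q) (a c : ℝ) :
    ∫ ω, Complex.exp (↑(a * ((1 + B ω) / 2 * Gp ω + (1 - B ω) / 2 * Gm ω) + c * B ω) *
      Complex.I) ∂P = (Real.exp (-(a ^ 2 * q / 2)) * Real.cos c : ℝ) := by
  have hplus : ∀ ω, Complex.exp (↑(a * ((1 + 1) / 2 * Gp ω + (1 - 1) / 2 * Gm ω) + c * 1) *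
      Complex.I) = Complex.exp (↑(a * Gp ω) * Complex.I) * Complex.exp (c * Complex.I) := by
    intro ω
    rw [← Complex.exp_add]
    push_cast
    ring_nf
  have hminus : ∀ ω, Complex.exp (↑(a * ((1 + -1) / 2 * Gp ω + (1 - -1) / 2 * Gm ω) + c * -1) *
      Complex.I) = Complex.exp (↑(a * Gm ω) * Complex.I) * Complex.exp (-c * Complex.I) := by
    intro ω
    rw [← Complex.exp_add]
    push_cast
    ring_nf
  rw [integral_comp_prodMk_sign hG.aemeasurable hB hGB (C := 1)
    (F := fun q => Complex.exp (↑(a * ((1 + q.2) / 2 * q.1.1 + (1 - q.2) / 2 * q.1.2) +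
      c * q.2) * Complex.I)) (by fun_prop) fun q => (Complex.norm_exp_ofReal_mul_I _).le]
  simp only [hplus, hminus]
  rw [integral_mul_const, integral_mul_const, integral_cexp_gaussian hG.fst hGp0,
    integral_cexp_gaussian hG.snd hGm0, hGp2, hGm2, Complex.real_smul]
  push_cast
  rw [Complex.cos]
  ring

namespace IsBrownianBridge

variable {Z : ℝ → Ω → ℝ} {p q : ℝ}

lemma hasGaussianLaw_two_mul_prodMk (hZ : IsBrownianBridge Z P) (hp : p ∈ Set.Icc (0 : ℝ) 1)
    (hq : q ∈ Set.Icc (0 : ℝ) 1) : HasGaussianLaw (fun ω => (2 * Z p ω, 2 * Z q ω)) P := by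
  simpa only [Prod.smul_mk, smul_eq_mul] using
    (hZ.isGaussianProcess.hasGaussianLaw_prodMk (s := ⟨p, hp⟩) (t := ⟨q, hq⟩)).fun_smul 2

lemma integral_two_mul (hZ : IsBrownianBridge Z P) (hp : p ∈ Set.Icc (0 : ℝ) 1) :
    ∫ ω, 2 * Z p ω ∂P = 0 := by
  rw [integral_const_mul, hZ.centred p hp, mul_zero]

lemma integral_two_mul_mul_two_mul (hZ : IsBrownianBridge Z P) (hp : p ∈ Set.Icc (0 : ℝ) 1)
    (hq : q ∈ Set.Icc (0 : ℝ) 1) :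
    ∫ ω, 2 * Z p ω * (2 * Z q ω) ∂P = 4 * (min p q - p * q) := by
  rw [← hZ.covariance p hp q hq, ← integral_const_mul]
  congr with ω
  ring

end IsBrownianBridge

end LimitLaw

section Convergence

variable {Ω : ℕ → Type*} [∀ n, MeasurableSpace (Ω n)] {P : (n : ℕ) → Measure (Ω n)}
  [∀ n, IsProbabilityMeasure (P n)] {Ω' : Type*} [MeasurableSpace Ω'] {P' : Measure Ω'}
  [IsProbabilityMeasure P']

lemma tendstoInDistribution_of_tendsto_integral_cexp_inner {E : Type*} [NormedAddCommGroup E]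
    [InnerProductSpace ℝ E] [FiniteDimensional ℝ E] [MeasurableSpace E] [BorelSpace E]
    {X : (n : ℕ) → Ω n → E} {X' : Ω' → E} (hX : ∀ n, AEMeasurable (X n) (P n))
    (hX' : AEMeasurable X' P')
    (h : ∀ a : E, Tendsto (fun n => ∫ ω, Complex.exp (inner ℝ (X n ω) a * Complex.I) ∂P n) atTop
      (𝓝 (∫ ω, Complex.exp (inner ℝ (X' ω) a * Complex.I) ∂P'))) :
    TendstoInDistribution X atTop X' P P' where
  forall_aemeasurable := hX
  aemeasurable_limit := hX'
  tendsto := by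
    refine ProbabilityMeasure.tendsto_of_tendsto_charFun fun a => ?_
    simp only [ProbabilityMeasure.coe_mk, charFun_apply]
    rw [integral_map hX' (by fun_prop)]
    exact (h a).congr fun n => (integral_map (hX n) (by fun_prop)).symm

lemma tendstoInDistribution_real_of_tendsto_integral_cexp {X : (n : ℕ) → Ω n → ℝ} {X' : Ω' → ℝ}
    (hX : ∀ n, AEMeasurable (X n) (P n)) (hX' : AEMeasurable X' P')
    (h : ∀ a : ℝ, Tendsto (fun n => ∫ ω, Complex.exp (↑(a * X n ω) * Complex.I) ∂P n) atTop
      (𝓝 (∫ ω, Complex.exp (↑(a * X' ω) * Complex.I) ∂P'))) :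
    TendstoInDistribution X atTop X' P P' :=
  tendstoInDistribution_of_tendsto_integral_cexp_inner hX hX' h

lemma tendstoInDistribution_prodMk_of_tendsto_integral_cexp {X Y : (n : ℕ) → Ω n → ℝ}
    {X' Y' : Ω' → ℝ} (hX : ∀ n, AEMeasurable (X n) (P n)) (hY : ∀ n, AEMeasurable (Y n) (P n))
    (hX' : AEMeasurable X' P') (hY' : AEMeasurable Y' P')
    (h : ∀ a b : ℝ, Tendsto
      (fun n => ∫ ω, Complex.exp (↑(a * X n ω + b * Y n ω) * Complex.I) ∂P n) atTop
      (𝓝 (∫ ω, Complex.exp (↑(a * X' ω + b * Y' ω) * Complex.I) ∂P'))) :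
    TendstoInDistribution (fun n ω => (X n ω, Y n ω)) atTop (fun ω => (X' ω, Y' ω)) P P' := by
  have htoLp := WithLp.measurable_toLp 2 (ℝ × ℝ)
  have hEuclidean : TendstoInDistribution (fun n ω => WithLp.toLp 2 (X n ω, Y n ω)) atTop
      (fun ω => WithLp.toLp 2 (X' ω, Y' ω)) P P' :=
    tendstoInDistribution_of_tendsto_integral_cexp_inner
      (fun n => htoLp.comp_aemeasurable ((hX n).prodMk (hY n)))
      (htoLp.comp_aemeasurable (hX'.prodMk hY'))
      fun a => by simpa [WithLp.prod_inner_apply] using h a.fst a.snd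
  exact hEuclidean.continuous_comp (WithLp.prod_continuous_ofLp 2 ℝ ℝ)

variable {β t : ℝ} {U : (n : ℕ) → Fin n → Ω n → ℝ} {V : (n : ℕ) → Ω n → ℝ} {B : Ω' → ℝ}

theorem tendsto_integral_cexp_magnetisation
    (hUV : ∀ n, IsDeFinettiCoupling β (U n) (V n) (P n)) (hβ : 0 < β) (ht_pos : 0 < t)
    (ht : t = Real.tanh (β * t)) {r : ℕ → ℝ} {v : ℝ}
    (hr : Tendsto (fun n : ℕ => n * r n ^ 2) atTop (𝓝 v)) (b : ℝ) :
    Tendsto (fun n : ℕ => ∫ ω,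
        Complex.exp (↑(r n * (magnetisation (fun k => U n k ω) (V n ω) - n * (2 * V n ω - 1)) +
          b * (2 * V n ω - 1)) * Complex.I) ∂P n) atTop
      (𝓝 (Real.exp (-(v * (1 - t ^ 2) / 2)) * Real.cos (b * t) : ℝ)) := by
  refine (tendsto_integral_spinCharFun_pow hβ ht_pos ht hr b).congr' ?_
  filter_upwards [eventually_gt_atTop 0] with n hn
  rw [(hUV n).integral_cexp_magnetisation hn]

theorem tendstoInDistribution_magnetisation_div
    (hUV : ∀ n, IsDeFinettiCoupling β (U n) (V n) (P n)) (hβ : 0 < β) (ht_pos : 0 < t)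
    (ht : t = Real.tanh (β * t)) (hB : HasLaw B signLaw P') :
    TendstoInDistribution (fun n ω => magnetisation (fun k => U n k ω) (V n ω) / n) atTop
      (fun ω => t * B ω) P P' := by
  refine tendstoInDistribution_real_of_tendsto_integral_cexp
    (fun n => (hUV n).aemeasurable_magnetisation.div_const _) (hB.aemeasurable.const_mul t)
    fun a => ?_
  have hr : Tendsto (fun n : ℕ => n * (a / n) ^ 2) atTop (𝓝 0) := by
    refine (tendsto_const_div_atTop_nhds_zero_nat (a ^ 2)).congr' ?_
    filter_upwards [eventually_ne_atTop 0] with n hn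
    field_simp
  have hlim := tendsto_integral_cexp_magnetisation hUV hβ ht_pos ht hr a
  simp only [← mul_assoc, integral_cexp_sign hB]
  simp only [zero_mul, zero_div, neg_zero, Real.exp_zero, one_mul] at hlim
  refine hlim.congr' ?_
  filter_upwards [eventually_ne_atTop 0] with n hn
  congr with ω
  congr 3
  field_simp
  ring

theorem tendstoInDistribution_fluctuations {Gp Gm : Ω' → ℝ}
    (hUV : ∀ n, IsDeFinettiCoupling β (U n) (V n) (P n)) (hβ : 0 < β) (ht_pos : 0 < t)
    (ht : t = Real.tanh (β * t)) (hB : HasLaw B signLaw P')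
    (hG : HasGaussianLaw (fun ω => (Gp ω, Gm ω)) P')
    (hGB : IndepFun (fun ω => (Gp ω, Gm ω)) B P') (hGp0 : ∫ ω, Gp ω ∂P' = 0)
    (hGm0 : ∫ ω, Gm ω ∂P' = 0) (hGp2 : ∫ ω, Gp ω * Gp ω ∂P' = 1 - t ^ 2)
    (hGm2 : ∫ ω, Gm ω * Gm ω ∂P' = 1 - t ^ 2) :
    TendstoInDistribution
      (fun (n : ℕ) ω =>
        (√(n : ℝ) * (magnetisation (fun k => U n k ω) (V n ω) / n - (2 * V n ω - 1)),
          2 * V n ω - 1)) atTop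
      (fun ω => ((1 + B ω) / 2 * Gp ω + (1 - B ω) / 2 * Gm ω, t * B ω)) P P' := by
  have hT : ∀ n, AEMeasurable (fun ω => 2 * V n ω - 1) (P n) := fun n =>
    ((hUV n).aemeasurable_param.const_mul 2).sub_const 1
  have hGp := hG.fst.aemeasurable
  have hGm := hG.snd.aemeasurable
  have hBm := hB.aemeasurable
  refine tendstoInDistribution_prodMk_of_tendsto_integral_cexp
    (fun n => (((hUV n).aemeasurable_magnetisation.div_const _).sub (hT n)).const_mul _) hT
    (by fun_prop) (hBm.const_mul t) fun a b => ?_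
  have hr : Tendsto (fun n : ℕ => n * (a / √n) ^ 2) atTop (𝓝 (a ^ 2)) := by
    refine tendsto_const_nhds.congr' ?_
    filter_upwards [eventually_ne_atTop 0] with n hn
    rw [div_pow, Real.sq_sqrt n.cast_nonneg]
    field_simp
  simp only [← mul_assoc b, integral_cexp_gaussian_mixture hG hB hGB hGp0 hGm0 hGp2 hGm2]
  refine (tendsto_integral_cexp_magnetisation hUV hβ ht_pos ht hr b).congr' ?_
  filter_upwards [eventually_ne_atTop 0] with n hn
  congr with ω
  congr 4
  have hn_sqrt : (n : ℝ) / √n = √n := Real.div_sqrt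
  have hn0 : (n : ℝ) ≠ 0 := Nat.cast_ne_zero.2 hn
  conv_rhs => rw [← hn_sqrt]
  field_simp

end Convergence

end CurieWeiss

theorem mainTheorem3
    (β : ℝ) (hβ : 1 < β)
    -- `t` is the positive solution of `t = tanh (β t)`
    (t : ℝ) (ht_pos : 0 < t) (ht : t = Real.tanh (β * t))
    -- for every `n`, i.i.d. uniform variables and an independent variable `V n` with the
    -- De Finetti law, on a probability space that may depend on `n`
    {Ω : ℕ → Type*} [∀ n, MeasurableSpace (Ω n)]
    (P : (n : ℕ) → Measure (Ω n)) [∀ n, IsProbabilityMeasure (P n)]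
    (U : (n : ℕ) → Fin n → Ω n → ℝ) (V : (n : ℕ) → Ω n → ℝ)
    (hU : ∀ n k, HasLaw (U n k) (volume.restrict (Set.Icc (0 : ℝ) 1)) (P n))
    (hU_indep : ∀ n, iIndepFun (U n) (P n))
    (hV_meas : ∀ n, AEMeasurable (V n) (P n))
    (hV : ∀ n, 0 < n → HasLaw (V n) (CurieWeiss.deFinettiMeasure n β) (P n))
    (hUV_indep : ∀ n, IndepFun (V n) (fun ω k => U n k ω) (P n))
    -- the probability space of the limit: a Brownian bridge `Z` and a symmetric sign `B`
    {Ω' : Type*} [MeasurableSpace Ω'] (P' : Measure Ω') [IsProbabilityMeasure P']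
    (Z : ℝ → Ω' → ℝ) (hZ : CurieWeiss.IsBrownianBridge Z P')
    (B : Ω' → ℝ) (hB : HasLaw B CurieWeiss.signLaw P')
    (M T : (n : ℕ) → Ω n → ℝ)
    (hM : ∀ n ω, M n ω = CurieWeiss.magnetisation (fun k => U n k ω) (V n ω))
    (hT : ∀ n ω, T n ω = 2 * V n ω - 1)
    (Gp Gm : Ω' → ℝ)
    (hGp : ∀ ω, Gp ω = 2 * Z ((1 + t) / 2) ω)
    (hGm : ∀ ω, Gm ω = 2 * Z ((1 - t) / 2) ω)
    (hGB_indep : IndepFun (fun ω => (Gp ω, Gm ω)) B P') :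
    -- the spins have the Curie-Weiss law, so `M n` is the Curie-Weiss magnetisation
    (∀ n, 0 < n → HasLaw (fun ω k => CurieWeiss.spin (U n k ω) (V n ω))
      (CurieWeiss.curieWeissLaw n β) (P n)) ∧
    -- law of large numbers
    TendstoInDistribution (fun (n : ℕ) ω => M n ω / n) atTop (fun ω => t * B ω) P P' ∧
    -- joint fluctuations
    TendstoInDistribution
      (fun (n : ℕ) ω => (√(n : ℝ) * (M n ω / n - T n ω), T n ω)) atTop
      (fun ω => ((1 + B ω) / 2 * Gp ω + (1 - B ω) / 2 * Gm ω, t * B ω)) P P' ∧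
    -- the law of the Gaussian pair
    HasGaussianLaw (fun ω => (Gp ω, Gm ω)) P' ∧
    ∫ ω, Gp ω ∂P' = 0 ∧ ∫ ω, Gm ω ∂P' = 0 ∧
    ∫ ω, Gp ω * Gm ω ∂P' = (1 - t) ^ 2 := by
  obtain rfl : M = fun n ω => CurieWeiss.magnetisation (fun k => U n k ω) (V n ω) :=
    funext fun n => funext (hM n)
  obtain rfl : T = fun n ω => 2 * V n ω - 1 := funext fun n => funext (hT n)
  obtain rfl : Gp = fun ω => 2 * Z ((1 + t) / 2) ω := funext hGp
  obtain rfl : Gm = fun ω => 2 * Z ((1 - t) / 2) ω := funext hGm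
  have hβ_pos : 0 < β := one_pos.trans hβ
  have ht_lt : t < 1 := ht ▸ Real.tanh_lt_one _
  have hp : (1 + t) / 2 ∈ Set.Icc (0 : ℝ) 1 := ⟨by linarith, by linarith⟩
  have hm : (1 - t) / 2 ∈ Set.Icc (0 : ℝ) 1 := ⟨by linarith, by linarith⟩
  have hUV : ∀ n, CurieWeiss.IsDeFinettiCoupling β (U n) (V n) (P n) := fun n =>
    ⟨hU n, hU_indep n, hV_meas n, hV n, hUV_indep n⟩
  have hG := hZ.hasGaussianLaw_two_mul_prodMk hp hm
  refine ⟨fun n hn => (hUV n).hasLaw_spins hβ_pos hn,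
    CurieWeiss.tendstoInDistribution_magnetisation_div hUV hβ_pos ht_pos ht hB,
    CurieWeiss.tendstoInDistribution_fluctuations hUV hβ_pos ht_pos ht hB hG hGB_indep
      (hZ.integral_two_mul hp) (hZ.integral_two_mul hm) ?_ ?_,
    hG, hZ.integral_two_mul hp, hZ.integral_two_mul hm, ?_⟩
  · rw [hZ.integral_two_mul_mul_two_mul hp hp, min_self]
    ring
  · rw [hZ.integral_two_mul_mul_two_mul hm hm, min_self]
    ring
  · rw [hZ.integral_two_mul_mul_two_mul hp hm, min_eq_right (by linarith)]
    ring
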